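/- Let $A$ be a finite set, let $\Omega=A^{\mathbb N}$ with its Borel (product) $\sigma$-algebra, and let $\mu$ be a stationary (shift-invariant) probability measure on $\Omega$. Let $\mathcal E$ be the set of ergodic laws, i.e. the extreme points of the set of shift-invariant probability measures on $\Omega$, with the $\sigma$-algebra generated by the maps $\nu\mapsto\nu(S)$, $S\subseteq\Omega$ Borel. For a probability measure $\nu$ on $\Omega$ and $(a_0,\dots,a_{n-1})\in A^n$ of positive $\nu$-probability, let $\nu(\cdot\mid a_0,\dots,a_{n-1})$ denote the conditional distribution under $\nu$ of the $n$-th coordinate given that the coordinates $0,\dots,n-1$ equal $a_0,\dots,a_{n-1}$, and for $p,q$ probability vectors on $A$ put $\|p-q\|=\max_{a\in A}|p[a]-q[a]|$. Then there is exactly one probability measure $\lambda$ on $\mathcal E$ with $\mu(S)=\int_{\mathcal E}\nu(S)\,\lambda(d\nu)$ for every Borel $S\subseteq\Omega$ (the ergodic decomposition of $\mu$), and this decomposition is weakly learnable: for $\lambda$-almost every $\nu\in\mathcal E$, for $\nu$-almost every $\omega=(a_0,a_1,\dots)\in\Omega$, one has $\mu(a_0,\dots,a_{n-1})>0$ for all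 $n$, where $\mu(a_0,\dots,a_{n-1})$ is the $\mu$-probability that the coordinates $0,\dots,n-1$ equal $a_0,\dots,a_{n-1}$, and $$\lim_{N\to\infty}\frac1N\sum_{n=0}^{N-1}\bigl\|\mu(\cdot\mid a_0,\dots,a_{n-1})-\nu(\cdot\mid a_0,\dots,a_{n-1})\bigr\|=0 .$$ -/

import Mathlib

open MeasureTheory ProbabilityTheory Filter Topology
open scoped ENNReal

namespace ErgLearn

/-- The left shift on the space of realizations `A^ℕ` (with the product sigma-algebra, which for
finite discrete `A` is the Borel sigma-algebra of the product topology). -/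
def shift (A : Type*) (ω : ℕ → A) : ℕ → A := fun n => ω (n + 1)

/-- Laws of stationary processes with values in `A`: shift-invariant probability measures. -/
def stationaryLaws (A : Type*) [MeasurableSpace A] : Set (Measure (ℕ → A)) :=
  {μ | IsProbabilityMeasure μ ∧ MeasurePreserving (shift A) μ μ}

/-- Ergodic laws: the extreme points of the convex set of stationary laws. -/
def ergodicLaws (A : Type*) [MeasurableSpace A] : Set (Measure (ℕ → A)) :=
  Set.extremePoints ℝ≥0∞ (stationaryLaws A)

/-- Extremality agrees with ergodicity of the shift in the usual (zero-one law) sense. -/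
theorem mem_ergodicLaws_iff {A : Type*} [MeasurableSpace A] {ν : Measure (ℕ → A)} :
    ν ∈ ergodicLaws A ↔ IsProbabilityMeasure ν ∧ Ergodic (shift A) ν := by
  have hS : stationaryLaws A =
      {ν | MeasurePreserving (shift A) ν ν ∧ IsProbabilityMeasure ν} := by
    ext ν; exact and_comm
  unfold ergodicLaws
  rw [hS]
  constructor
  · intro h
    have : IsProbabilityMeasure ν := h.1.2
    exact ⟨this, Ergodic.iff_mem_extremePoints.2 h⟩
  · rintro ⟨hp, he⟩
    exact Ergodic.iff_mem_extremePoints.1 he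

/-- The cylinder of all realizations whose first `n` outcomes are those of `ω`. -/
def cylinder {A : Type*} (n : ℕ) (ω : ℕ → A) : Set (ℕ → A) :=
  {η | ∀ i < n, η i = ω i}

/-- The `n`-period predictive distribution `ν(· | ω₀, …, ωₙ₋₁)` as a vector of probabilities: the
conditional probability under `ν` that the outcome at time `n` is `a`, given the first `n` outcomes
of `ω`. It is meaningful when `ν (cylinder n ω) > 0`. -/
noncomputable def predictive {A : Type*} [MeasurableSpace A] (ν : Measure (ℕ → A)) (n : ℕ)
    (ω : ℕ → A) : A → ℝ :=
  fun a => (ν[|cylinder n ω]).real {η | η n = a}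

/-- Strong Cesàro convergence of a (bounded) real sequence. -/
def StrongCesaroTendsto (x : ℕ → ℝ) (l : ℝ) : Prop :=
  Tendsto (fun N : ℕ => (1 / (N : ℝ)) * ∑ n ∈ Finset.range N, |x n - l|) atTop (𝓝 0)

/-- The belief `μ` weakly merges to the law `ν`: for `ν`-almost every realization, the predictions
of `μ` are defined in every period, and their distance to those of `ν` tends to zero in the strong
Cesàro sense. The norm on `A → ℝ` is the maximum norm. (The predictions of `ν` are defined in
every period `ν`-almost surely.) -/
def WeaklyMerges {A : Type*} [Fintype A] [MeasurableSpace A] (μ ν : Measure (ℕ → A)) : Prop :=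
  ∀ᵐ ω ∂ν, (∀ n, 0 < μ (cylinder n ω)) ∧
    StrongCesaroTendsto (fun n => ‖predictive μ n ω - predictive ν n ω‖) 0

/-- `(Θ, lam, (ν θ))` is a decomposition of `μ`: `lam` is a probability measure on the parameter
space and `μ` is the `lam`-mixture of the measurable family of probability measures `ν θ`. -/
structure IsDecomposition {A : Type*} [MeasurableSpace A] (μ : Measure (ℕ → A))
    {Θ : Type*} [MeasurableSpace Θ] (lam : Measure Θ) (ν : Θ → Measure (ℕ → A)) : Prop where
  prob_parameter : IsProbabilityMeasure lam
  prob_component : ∀ θ, IsProbabilityMeasure (ν θ)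
  measurable_component : ∀ S, MeasurableSet S → Measurable fun θ => ν θ S
  mixture : ∀ S, MeasurableSet S → μ S = ∫⁻ θ, ν θ S ∂lam

/-- A decomposition is weakly learnable if `μ` weakly merges to almost every component. -/
def WeaklyLearnable {A : Type*} [Fintype A] [MeasurableSpace A] (μ : Measure (ℕ → A))
    {Θ : Type*} [MeasurableSpace Θ] (lam : Measure Θ) (ν : Θ → Measure (ℕ → A)) : Prop :=
  ∀ᵐ θ ∂lam, WeaklyMerges μ (ν θ)

/-- `lam` is the mixing measure of an ergodic decomposition of `μ`: the parameter space is the set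
of ergodic laws itself, each parametrizing itself. Its sigma-algebra is generated by the evaluations
`ν ↦ ν S`, `S` measurable; for finite `A` it is the Borel sigma-algebra of the weak-star
topology. -/
def IsErgodicDecomposition {A : Type*} [MeasurableSpace A] (μ : Measure (ℕ → A))
    (lam : Measure (ergodicLaws A)) : Prop :=
  IsDecomposition μ lam (fun ν : ergodicLaws A => (ν : Measure (ℕ → A)))

end ErgLearn

/-!
The ergodic decomposition of a stationary law on `A^ℕ`, and its weak learnability.

*The decomposition.* The mixing measure is the law of the conditional distribution of `μ` given the
shift-invariant sets. Birkhoff's theorem (`ae_tendsto_birkhoffAverage`) shows that the conditional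
distributions are ergodic (`ae_ergodic_condExpKernel_invariants`): given the invariant sets, visit
frequencies converge to constants, and this forces every invariant set to be independent of itself
(`ergodic_of_ae_tendsto_visitFreq`). For uniqueness, the limiting visit frequencies of the countably
many initial cylinders are functions of the sequence that return, almost surely under each ergodic
law, the values of that law. So the law of these functions under `μ` determines the mixing measure
(`IsErgodicDecomposition.unique`).

*Learnability.* Consider the joint law `P` of a component `ν` and a sequence drawn from `ν`; it is
invariant under the shift of the sequence. For a letter `a` fix a time `L` and consider, for
`k ≤ L`, the predictions of the event that the letter at time `L` is `a` made from the preceding `k` letters,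
once with `μ` (the observer does not know `ν`) and once with `ν`. By stationarity both are
conditional expectations of the same indicator under `P`, given increasing information, so that
their second moments `c k ≤ c' k` increase with `k` and do not depend on `L`. Since the component is a
function of the sequence, and an invariant one, it can be estimated from the remote past as well as
from any other stretch; hence `c' k ≤ sup c` (`integral_sq_predictive_kernel_le`). By Pythagoras
the two predictions are then close in mean square for large `k`, and by Doob's inequality the same
holds for the maximum of their distance over all `k` between `m` and `L`, with a bound that is
uniform in `L` and vanishes as `m → ∞` (`measureReal_exists_le_predictionGap_le`).

The sequence of prediction gaps along a realization is not stationary, since the length of the past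
grows with time. But `L` steps later it is dominated by the stationary sequence of these maxima,
to which the maximal ergodic inequality applies
(`measureReal_exists_lt_sum_predictionGap_le`). The resulting bound on the upper limit of the
averages is arbitrarily small. This takes the place of the usual argument with a two-sided extension
of the process, in which the past is infinite.
-/

namespace ErgLearn

/-! ### The maximal ergodic inequality -/

section Dynamics

variable {X : Type*} {T : X → X}

/-- The running maximum `max_{0 ≤ n ≤ L}` of the Birkhoff sums of `h`, by recursion on `L`. -/
noncomputable def maxBirkhoffSum (T : X → X) (h : X → ℝ) : ℕ → X → ℝ
  | 0, _ => 0
  | L + 1, x => max 0 (h x + maxBirkhoffSum T h L (T x))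

lemma maxBirkhoffSum_nonneg (h : X → ℝ) (L : ℕ) (x : X) : 0 ≤ maxBirkhoffSum T h L x := by
  cases L <;> simp [maxBirkhoffSum]

lemma maxBirkhoffSum_le_succ (h : X → ℝ) (L : ℕ) (x : X) :
    maxBirkhoffSum T h L x ≤ maxBirkhoffSum T h (L + 1) x := by
  induction L generalizing x with
  | zero => exact maxBirkhoffSum_nonneg h 1 x
  | succ L ih => exact max_le_max le_rfl (by gcongr; exact ih _)

lemma maxBirkhoffSum_pos_iff (h : X → ℝ) (L : ℕ) (x : X) :
    0 < maxBirkhoffSum T h L x ↔ ∃ n ≤ L, 0 < birkhoffSum T h n x := by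
  have le_max : ∀ (L : ℕ) (x : X), ∀ n ≤ L, birkhoffSum T h n x ≤ maxBirkhoffSum T h L x := by
    intro L
    induction L with
    | zero => intro x n hn; simp [Nat.le_zero.1 hn, maxBirkhoffSum]
    | succ L ih =>
      intro x n hn
      cases n with
      | zero => simpa using maxBirkhoffSum_nonneg h (L + 1) x
      | succ n =>
        rw [birkhoffSum_succ']
        exact le_max_of_le_right (by gcongr; exact ih _ _ (by omega))
  have attained : ∀ (L : ℕ) (x : X), ∃ n ≤ L, maxBirkhoffSum T h L x = birkhoffSum T h n x := by
    intro L
    induction L with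
    | zero => intro x; exact ⟨0, le_rfl, by simp [maxBirkhoffSum]⟩
    | succ L ih =>
      intro x
      obtain ⟨n, hn, e⟩ := ih (T x)
      rcases max_choice 0 (h x + maxBirkhoffSum T h L (T x)) with h0 | h0
      · exact ⟨0, by omega, by rw [maxBirkhoffSum, h0]; simp⟩
      · exact ⟨n + 1, by omega, by rw [maxBirkhoffSum, h0, birkhoffSum_succ', e]⟩
  constructor
  · intro hp
    obtain ⟨n, hn, e⟩ := attained L x
    exact ⟨n, hn, e ▸ hp⟩
  · rintro ⟨n, hn, hp⟩
    exact hp.trans_le (le_max L x n hn)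

variable [MeasurableSpace X] {μ : Measure X}

lemma _root_.MeasureTheory.MeasurePreserving.integral_comp_of_aestronglyMeasurable {Y : Type*}
    [MeasurableSpace Y] {ν : Measure Y} {g : X → Y} (hg : MeasurePreserving g μ ν) {f : Y → ℝ}
    (hf : AEStronglyMeasurable f ν) : ∫ x, f (g x) ∂μ = ∫ y, f y ∂ν := by
  rw [← integral_map hg.measurable.aemeasurable (by rwa [hg.map_eq]), hg.map_eq]

lemma measurable_birkhoffSum (hT : Measurable T) {h : X → ℝ} (hh : Measurable h) (n : ℕ) :
    Measurable (birkhoffSum T h n) := by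
  unfold birkhoffSum
  exact Finset.measurable_fun_sum _ fun i _ => hh.comp (hT.iterate i)

lemma measurable_birkhoffAverage (hT : Measurable T) {h : X → ℝ} (hh : Measurable h) (n : ℕ) :
    Measurable (birkhoffAverage ℝ T h n) := by
  unfold birkhoffAverage
  exact (measurable_birkhoffSum hT hh n).const_smul ((n : ℝ)⁻¹)

lemma measurable_maxBirkhoffSum (hT : Measurable T) {h : X → ℝ} (hh : Measurable h) (L : ℕ) :
    Measurable (maxBirkhoffSum T h L) := by
  induction L with
  | zero => exact measurable_const
  | succ L ih => exact measurable_const.max (hh.add (ih.comp hT))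

lemma integrable_maxBirkhoffSum (hT : MeasurePreserving T μ μ) {h : X → ℝ}
    (hi : Integrable h μ) (L : ℕ) : Integrable (maxBirkhoffSum T h L) μ := by
  induction L with
  | zero => exact integrable_zero _ _ _
  | succ L ih =>
    exact (integrable_zero _ _ _).sup (hi.add ((hT.integrable_comp ih.aestronglyMeasurable).2 ih))

/-- The maximal ergodic inequality: on the set where some Birkhoff sum of `h` of length at most
`L` is positive, `h` dominates a coboundary of the running maximum. -/
theorem setIntegral_nonneg_of_exists_birkhoffSum_pos (hT : MeasurePreserving T μ μ) {h : X → ℝ}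
    (hh : Measurable h) (hi : Integrable h μ) (L : ℕ) :
    0 ≤ ∫ x in {x | ∃ n ≤ L, 0 < birkhoffSum T h n x}, h x ∂μ := by
  cases L with
  | zero => simp
  | succ L =>
    set M := maxBirkhoffSum T h (L + 1) with hM
    have hMi : Integrable M μ := integrable_maxBirkhoffSum hT hi _
    have hMTi : Integrable (fun x => M (T x)) μ :=
      (hT.integrable_comp hMi.aestronglyMeasurable).2 hMi
    have hset : {x | ∃ n ≤ L + 1, 0 < birkhoffSum T h n x} = {x | 0 < M x} := by
      ext x; exact (maxBirkhoffSum_pos_iff h (L + 1) x).symm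
    have hB : MeasurableSet {x | 0 < M x} :=
      measurableSet_lt measurable_const (measurable_maxBirkhoffSum hT.measurable hh _)
    rw [hset]
    have h1 : ∫ x in {x | 0 < M x}, (M x - M (T x)) ∂μ ≤ ∫ x in {x | 0 < M x}, h x ∂μ := by
      refine setIntegral_mono_on (hMi.sub hMTi).integrableOn hi.integrableOn hB fun x hx => ?_
      have hx' : 0 < max 0 (h x + maxBirkhoffSum T h L (T x)) := hx
      have e : M x = h x + maxBirkhoffSum T h L (T x) := by
        rcases max_choice 0 (h x + maxBirkhoffSum T h L (T x)) with h0 | h0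
        · rw [h0] at hx'; exact absurd hx' (lt_irrefl _)
        · exact h0
      have := maxBirkhoffSum_le_succ (T := T) h L (T x)
      rw [e, hM]; linarith
    refine le_trans ?_ h1
    rw [integral_sub hMi.integrableOn hMTi.integrableOn]
    have e1 : ∫ x in {x | 0 < M x}, M x ∂μ = ∫ x, M x ∂μ := by
      refine setIntegral_eq_integral_of_forall_compl_eq_zero fun x hx => ?_
      exact le_antisymm (not_lt.1 hx) (maxBirkhoffSum_nonneg h _ x)
    have e2 : ∫ x in {x | 0 < M x}, M (T x) ∂μ ≤ ∫ x, M (T x) ∂μ :=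
      setIntegral_le_integral hMTi (ae_of_all _ fun x => maxBirkhoffSum_nonneg h _ _)
    have e3 : ∫ x, M (T x) ∂μ = ∫ x, M x ∂μ :=
      hT.integral_comp_of_aestronglyMeasurable hMi.aestronglyMeasurable
    linarith

/-- The maximal ergodic inequality over an unbounded horizon. -/
theorem setIntegral_nonneg_of_exists_birkhoffSum_pos' (hT : MeasurePreserving T μ μ) {h : X → ℝ}
    (hh : Measurable h) (hi : Integrable h μ) :
    0 ≤ ∫ x in {x | ∃ n, 0 < birkhoffSum T h n x}, h x ∂μ := by
  have hset : {x | ∃ n, 0 < birkhoffSum T h n x} =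
      ⋃ L, {x | ∃ n ≤ L, 0 < birkhoffSum T h n x} := by
    ext x; simp only [Set.mem_ofPred_eq, Set.mem_iUnion]
    exact ⟨fun ⟨n, hn⟩ => ⟨n, n, le_rfl, hn⟩, fun ⟨_, n, _, hn⟩ => ⟨n, hn⟩⟩
  have hmeas : ∀ L, MeasurableSet {x | ∃ n ≤ L, 0 < birkhoffSum T h n x} := by
    intro L
    have : {x | ∃ n ≤ L, 0 < birkhoffSum T h n x} =
        {x | 0 < maxBirkhoffSum T h L x} := by
      ext x; exact (maxBirkhoffSum_pos_iff h L x).symm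
    rw [this]
    exact measurableSet_lt measurable_const (measurable_maxBirkhoffSum hT.measurable hh _)
  rw [hset]
  refine ge_of_tendsto' (tendsto_setIntegral_of_monotone hmeas ?_ hi.integrableOn) fun L =>
    setIntegral_nonneg_of_exists_birkhoffSum_pos hT hh hi L
  exact fun L L' hL x ⟨n, hn, hp⟩ => ⟨n, hn.trans hL, hp⟩

/-- The weak-type maximal inequality for Birkhoff sums of a nonnegative function. -/
theorem measureReal_exists_birkhoffSum_gt_le [IsProbabilityMeasure μ]
    (hT : MeasurePreserving T μ μ) {G : X → ℝ} (hG : Measurable G) (hi : Integrable G μ)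
    (h0 : ∀ x, 0 ≤ G x) {ε : ℝ} (hε : 0 < ε) (L : ℕ) :
    μ.real {x | ∃ n ≤ L, ε * n < birkhoffSum T G n x} ≤ (∫ x, G x ∂μ) / ε := by
  have key := setIntegral_nonneg_of_exists_birkhoffSum_pos hT (hG.sub_const ε)
    (hi.sub (integrable_const ε)) L
  have hset : {x | ∃ n ≤ L, 0 < birkhoffSum T (fun x => G x - ε) n x} =
      {x | ∃ n ≤ L, ε * n < birkhoffSum T G n x} := by
    ext x
    have : ∀ n : ℕ, birkhoffSum T (fun x => G x - ε) n x = birkhoffSum T G n x - ε * n := by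
      intro n; simp [birkhoffSum, mul_comm]
    simp only [Set.mem_ofPred_eq, this, sub_pos]
  rw [hset, integral_sub hi.integrableOn (integrable_const ε)] at key
  simp only [integral_const, smul_eq_mul, measureReal_restrict_apply_univ] at key
  rw [le_div_iff₀ hε]
  have := setIntegral_le_integral (s := {x | ∃ n ≤ L, ε * n < birkhoffSum T G n x}) hi
    (ae_of_all _ h0)
  linarith

end Dynamics
/-! ### The pointwise ergodic theorem -/

section Birkhoff

variable {X : Type*} {T : X → X} {f : X → ℝ} {C : ℝ}

/-- The upper limit of the Birkhoff averages of `f`. For bounded `f` it is invariant under `T` at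
every point, not only almost everywhere. -/
noncomputable def birkhoffLimsup (T : X → X) (f : X → ℝ) (x : X) : ℝ :=
  limsup (fun n => birkhoffAverage ℝ T f n x) atTop

lemma abs_indicator_one_le (S : Set X) (x : X) : |S.indicator (1 : X → ℝ) x| ≤ 1 := by
  by_cases h : x ∈ S <;> simp [h]

lemma abs_birkhoffAverage_le (hf : ∀ x, |f x| ≤ C) (n : ℕ) (x : X) :
    |birkhoffAverage ℝ T f n x| ≤ C := by
  have hC : 0 ≤ C := (abs_nonneg _).trans (hf x)
  rcases Nat.eq_zero_or_pos n with rfl | hn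
  · simpa using hC
  · have hn' : (0 : ℝ) < n := by exact_mod_cast hn
    rw [birkhoffAverage, smul_eq_mul, abs_mul, abs_of_pos (inv_pos.2 hn'), inv_mul_le_iff₀ hn',
      birkhoffSum]
    refine (Finset.abs_sum_le_sum_abs _ _).trans ?_
    simpa using Finset.sum_le_card_nsmul (Finset.range n) _ C fun i _ => hf (T^[i] x)

lemma isBoundedUnder_birkhoffAverage (hf : ∀ x, |f x| ≤ C) (x : X) :
    IsBoundedUnder (· ≤ ·) atTop (fun n => birkhoffAverage ℝ T f n x) :=
  isBoundedUnder_of ⟨C, fun n => (abs_le.1 (abs_birkhoffAverage_le hf n x)).2⟩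

lemma isCoboundedUnder_birkhoffAverage (hf : ∀ x, |f x| ≤ C) (x : X) :
    IsCoboundedUnder (· ≤ ·) atTop (fun n => birkhoffAverage ℝ T f n x) :=
  (isBoundedUnder_of ⟨-C, fun n => (abs_le.1 (abs_birkhoffAverage_le hf n x)).1⟩ :
    IsBoundedUnder (· ≥ ·) atTop _).isCoboundedUnder_le

lemma birkhoffLimsup_apply (hf : ∀ x, |f x| ≤ C) (x : X) :
    birkhoffLimsup T f (T x) = birkhoffLimsup T f x := by
  have h0 : Tendsto (fun n => birkhoffAverage ℝ T f n (T x) - birkhoffAverage ℝ T f n x)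
      atTop (𝓝 0) := by
    refine tendsto_birkhoffAverage_apply_sub_birkhoffAverage' ℝ ?_ T x
    exact (Metric.isBounded_iff_subset_closedBall 0).2
      ⟨C, by rintro _ ⟨y, rfl⟩; simpa using hf y⟩
  have aux : ∀ y z, Tendsto (fun n => birkhoffAverage ℝ T f n y - birkhoffAverage ℝ T f n z)
      atTop (𝓝 0) → birkhoffLimsup T f y ≤ birkhoffLimsup T f z := by
    intro y z h
    refine le_of_forall_pos_le_add fun ε hε => ?_
    refine limsup_le_of_le (isCoboundedUnder_birkhoffAverage hf y) ?_
    have h1 : ∀ᶠ n in atTop, birkhoffAverage ℝ T f n z < birkhoffLimsup T f z + ε / 2 :=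
      eventually_lt_of_limsup_lt (by unfold birkhoffLimsup; linarith)
        (isBoundedUnder_birkhoffAverage hf z)
    filter_upwards [h1, h.eventually (gt_mem_nhds (half_pos hε))] with n h2 h3
    linarith
  refine le_antisymm (aux _ _ h0) (aux _ _ ?_)
  simpa using h0.neg

variable [MeasurableSpace X] {μ : Measure X}

lemma measurable_birkhoffLimsup (hT : Measurable T) (hf : Measurable f) :
    Measurable (birkhoffLimsup T f) :=
  Measurable.limsup fun n => measurable_birkhoffAverage hT hf n

lemma measurable_invariants_birkhoffLimsup (hT : Measurable T) (hf : Measurable f)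
    (hC : ∀ x, |f x| ≤ C) :
    Measurable[MeasurableSpace.invariants T] (birkhoffLimsup T f) := by
  rw [MeasurableSpace.measurable_invariants_dom]
  refine ⟨measurable_birkhoffLimsup hT hf, fun s _ => ?_⟩
  ext x
  simp [birkhoffLimsup_apply hC]

lemma integrable_of_abs_le [IsFiniteMeasure μ] (hf : Measurable f) (hC : ∀ x, |f x| ≤ C) :
    Integrable f μ :=
  Integrable.of_bound hf.aestronglyMeasurable C (ae_of_all _ hC)

/-- On an invariant set where the upper limit of the averages of `f` exceeds `β`, the mean of `f`
is at least `β`: the maximal inequality applied to `f - β`, cut off outside the set. -/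
lemma setIntegral_sub_nonneg_of_lt_birkhoffLimsup [IsFiniteMeasure μ]
    (hT : MeasurePreserving T μ μ) (hf : Measurable f) (hC : ∀ x, |f x| ≤ C) {E : Set X}
    (hE : MeasurableSet E) (hTE : T ⁻¹' E = E) {β : ℝ} (hβ : ∀ x ∈ E, β < birkhoffLimsup T f x) :
    0 ≤ ∫ x in E, (f x - β) ∂μ := by
  set h : X → ℝ := E.indicator (fun x => f x - β)
  have hm : Measurable h := (hf.sub_const β).indicator hE
  have hi : Integrable h μ :=
    ((integrable_of_abs_le hf hC).sub (integrable_const β)).indicator hE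
  have key := setIntegral_nonneg_of_exists_birkhoffSum_pos' hT hm hi
  have hiter : ∀ (i : ℕ) (x : X), T^[i] x ∈ E ↔ x ∈ E := by
    intro i x
    have : T^[i] ⁻¹' E = E := by
      induction i with
      | zero => rfl
      | succ i ih => rw [Function.iterate_succ, Set.preimage_comp, ih, hTE]
    exact Set.ext_iff.1 this x
  have hset : {x | ∃ n, 0 < birkhoffSum T h n x} = E := by
    ext x
    simp only [Set.mem_ofPred_eq]
    constructor
    · rintro ⟨n, hn⟩
      by_contra hx
      have : birkhoffSum T h n x = 0 :=
        Finset.sum_eq_zero fun i _ => Set.indicator_of_notMem (by rwa [hiter]) _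
      linarith
    · intro hx
      have hfr : ∃ᶠ n in atTop, β < birkhoffAverage ℝ T f n x :=
        frequently_lt_of_lt_limsup (isCoboundedUnder_birkhoffAverage hC x) (hβ x hx)
      obtain ⟨n, hn, hn0⟩ := (hfr.and_eventually (eventually_gt_atTop 0)).exists
      have hn' : (0 : ℝ) < n := by exact_mod_cast hn0
      refine ⟨n, ?_⟩
      have : birkhoffSum T h n x = birkhoffSum T f n x - n * β := by
        have : ∀ i ∈ Finset.range n, h (T^[i] x) = f (T^[i] x) - β := fun i _ =>
          Set.indicator_of_mem ((hiter i x).2 hx) _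
        rw [birkhoffSum, Finset.sum_congr rfl this]
        simp [birkhoffSum]
      rw [this, sub_pos]
      rw [birkhoffAverage, smul_eq_mul, lt_inv_mul_iff₀ hn'] at hn
      exact hn
  rw [hset] at key
  rwa [setIntegral_congr_fun hE fun x hx => Set.indicator_of_mem hx _] at key

/-- Birkhoff's pointwise ergodic theorem for bounded functions. -/
theorem ae_tendsto_birkhoffAverage [IsFiniteMeasure μ] (hT : MeasurePreserving T μ μ)
    (hf : Measurable f) (hC : ∀ x, |f x| ≤ C) :
    ∀ᵐ x ∂μ, Tendsto (fun n => birkhoffAverage ℝ T f n x) atTop (𝓝 (birkhoffLimsup T f x)) := by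
  have hC' : ∀ x, |(-f) x| ≤ C := fun x => by simpa using hC x
  have key : ∀ α β : ℚ, (α : ℝ) < β →
      ∀ᵐ x ∂μ, ¬ (-(α : ℝ) < birkhoffLimsup T (-f) x ∧ (β : ℝ) < birkhoffLimsup T f x) := by
    intro α β hαβ
    set E := {x | -(α : ℝ) < birkhoffLimsup T (-f) x ∧ (β : ℝ) < birkhoffLimsup T f x} with hEdef
    have hE : MeasurableSet E :=
      (measurableSet_lt measurable_const (measurable_birkhoffLimsup hT.measurable hf.neg)).inter
        (measurableSet_lt measurable_const (measurable_birkhoffLimsup hT.measurable hf))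
    have hTE : T ⁻¹' E = E := by
      ext x
      simp only [hEdef, Set.mem_preimage, Set.mem_ofPred_eq, birkhoffLimsup_apply hC,
        birkhoffLimsup_apply hC']
    have h1 := setIntegral_sub_nonneg_of_lt_birkhoffLimsup (μ := μ) hT hf hC hE hTE
      fun x hx => hx.2
    have h2 := setIntegral_sub_nonneg_of_lt_birkhoffLimsup (μ := μ) hT hf.neg hC' hE hTE
      fun x hx => hx.1
    have hfi := integrable_of_abs_le (μ := μ) hf hC
    have hfi' := integrable_of_abs_le (μ := μ) hf.neg hC'
    have h3 : 0 ≤ ∫ x in E, ((α : ℝ) - β) ∂μ := by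
      have := add_nonneg h1 h2
      rw [← integral_add (f := fun x => f x - (β : ℝ)) (g := fun x => (-f) x - -(α : ℝ))
        (hfi.sub (integrable_const _)).integrableOn
        (hfi'.sub (integrable_const _)).integrableOn] at this
      refine this.trans_eq (integral_congr_ae (ae_of_all _ fun x => ?_))
      simp only [Pi.neg_apply]; ring
    rw [setIntegral_const, smul_eq_mul] at h3
    have h4 : μ.real E = 0 := by
      by_contra hne
      have : 0 < μ.real E := lt_of_le_of_ne measureReal_nonneg (Ne.symm hne)
      nlinarith
    exact measure_eq_zero_iff_ae_notMem.1 ((measureReal_eq_zero_iff).1 h4)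
  have key' : ∀ᵐ x ∂μ, ∀ α β : ℚ, (α : ℝ) < β →
      ¬ (-(α : ℝ) < birkhoffLimsup T (-f) x ∧ (β : ℝ) < birkhoffLimsup T f x) := by
    simp only [ae_all_iff]; exact key
  filter_upwards [key'] with x hx
  have hle : birkhoffLimsup T f x ≤ -birkhoffLimsup T (-f) x := by
    by_contra hlt
    obtain ⟨α, h1, h2⟩ := exists_rat_btwn (not_le.1 hlt)
    obtain ⟨β, h3, h4⟩ := exists_rat_btwn h2
    exact hx α β h3 ⟨by linarith, h4⟩
  refine tendsto_order.2 ⟨fun a ha => ?_, fun b hb =>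
    eventually_lt_of_limsup_lt hb (isBoundedUnder_birkhoffAverage hC x)⟩
  have h5 : birkhoffLimsup T (-f) x < -a := by linarith
  have h6 := eventually_lt_of_limsup_lt h5 (isBoundedUnder_birkhoffAverage hC' x)
  filter_upwards [h6] with n hn
  rw [birkhoffAverage_neg] at hn
  simp only [Pi.neg_apply] at hn
  linarith

lemma integral_birkhoffAverage [IsFiniteMeasure μ] (hT : MeasurePreserving T μ μ)
    (hf : Measurable f) (hC : ∀ x, |f x| ≤ C) {S : Set X} (hS : MeasurableSet S)
    (hTS : T ⁻¹' S = S) {n : ℕ} (hn : n ≠ 0) :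
    ∫ x in S, birkhoffAverage ℝ T f n x ∂μ = ∫ x in S, f x ∂μ := by
  have hTS' : MeasurePreserving T (μ.restrict S) (μ.restrict S) := by
    have := hT.restrict_preimage hS
    rwa [hTS] at this
  have hfi := integrable_of_abs_le (μ := μ.restrict S) hf hC
  have h1 : ∀ i, ∫ x in S, f (T^[i] x) ∂μ = ∫ x in S, f x ∂μ := fun i =>
    (hTS'.iterate i).integral_comp_of_aestronglyMeasurable hfi.aestronglyMeasurable
  simp only [birkhoffAverage, birkhoffSum, smul_eq_mul]
  rw [integral_const_mul, integral_finsetSum]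
  · simp only [h1, Finset.sum_const, Finset.card_range, nsmul_eq_mul]
    field_simp
  · intro i _
    exact ((hTS'.iterate i).integrable_comp hfi.aestronglyMeasurable).2 hfi

/-- If the Birkhoff averages of `f` converge to a constant, they converge to it also in mean on
every invariant set. -/
lemma setIntegral_eq_of_ae_tendsto_const [IsFiniteMeasure μ] (hT : MeasurePreserving T μ μ)
    (hf : Measurable f) (hC : ∀ x, |f x| ≤ C) {c : ℝ}
    (hc : ∀ᵐ x ∂μ, Tendsto (fun n => birkhoffAverage ℝ T f n x) atTop (𝓝 c))
    {S : Set X} (hS : MeasurableSet S) (hTS : T ⁻¹' S = S) :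
    ∫ x in S, f x ∂μ = μ.real S * c := by
  have h1 : Tendsto (fun n => ∫ x in S, birkhoffAverage ℝ T f n x ∂μ) atTop
      (𝓝 (∫ x in S, c ∂μ)) :=
    tendsto_integral_of_dominated_convergence (fun _ => C)
      (fun n => (measurable_birkhoffAverage hT.measurable hf n).aestronglyMeasurable)
      (integrable_const C) (fun n => ae_of_all _ fun x => abs_birkhoffAverage_le hC n x)
      (ae_restrict_of_ae hc)
  have h2 : Tendsto (fun n => ∫ x in S, birkhoffAverage ℝ T f n x ∂μ) atTop
      (𝓝 (∫ x in S, f x ∂μ)) := by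
    refine tendsto_const_nhds.congr' ?_
    filter_upwards [eventually_ne_atTop 0] with n hn
    exact (integral_birkhoffAverage hT hf hC hS hTS hn).symm
  rw [tendsto_nhds_unique h2 h1, setIntegral_const, smul_eq_mul]

/-- The ergodic theorem for bounded functions: time averages converge to the space average. -/
theorem _root_.Ergodic.ae_tendsto_birkhoffAverage [IsProbabilityMeasure μ] (hT : Ergodic T μ)
    (hf : Measurable f) (hC : ∀ x, |f x| ≤ C) :
    ∀ᵐ x ∂μ, Tendsto (fun n => birkhoffAverage ℝ T f n x) atTop (𝓝 (∫ x, f x ∂μ)) := by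
  obtain ⟨c, hc⟩ := hT.toPreErgodic.ae_eq_const_of_ae_eq_comp
    (measurable_birkhoffLimsup hT.measurable hf) (funext fun x => birkhoffLimsup_apply hC x)
  have h1 : ∀ᵐ x ∂μ, Tendsto (fun n => birkhoffAverage ℝ T f n x) atTop (𝓝 c) := by
    filter_upwards [ErgLearn.ae_tendsto_birkhoffAverage hT.toMeasurePreserving hf hC, hc]
      with x hx hxc
    rwa [hxc] at hx
  have h2 := setIntegral_eq_of_ae_tendsto_const hT.toMeasurePreserving hf hC h1
    MeasurableSet.univ rfl
  simp only [Measure.restrict_univ, probReal_univ, one_mul] at h2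
  rwa [h2]

/-- The averages along `T` of the indicator of `S`: the visit frequencies of `S`. -/
noncomputable def visitFreq (T : X → X) (S : Set X) (n : ℕ) (x : X) : ℝ :=
  birkhoffAverage ℝ T (S.indicator 1) n x

lemma measurable_visitFreq (hT : Measurable T) {S : Set X} (hS : MeasurableSet S) (n : ℕ) :
    Measurable (visitFreq T S n) :=
  measurable_birkhoffAverage hT (measurable_one.indicator hS) n

theorem _root_.Ergodic.ae_tendsto_visitFreq [IsProbabilityMeasure μ] (hT : Ergodic T μ)
    {S : Set X} (hS : MeasurableSet S) :
    ∀ᵐ x ∂μ, Tendsto (fun n => visitFreq T S n x) atTop (𝓝 (μ.real S)) := by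
  have := hT.ae_tendsto_birkhoffAverage (measurable_one.indicator hS) (abs_indicator_one_le S)
  rwa [integral_indicator_one hS] at this

/-- Ergodicity from the law of large numbers on a generating π-system: each set of the π-system is
then independent of each invariant set, so an invariant set is independent of itself. -/
theorem ergodic_of_ae_tendsto_visitFreq [IsProbabilityMeasure μ] (hT : MeasurePreserving T μ μ)
    {𝒞 : Set (Set X)} (hgen : ‹MeasurableSpace X› = MeasurableSpace.generateFrom 𝒞)
    (hpi : IsPiSystem 𝒞) (c : Set X → ℝ)
    (h : ∀ S ∈ 𝒞, ∀ᵐ x ∂μ, Tendsto (fun n => visitFreq T S n x) atTop (𝓝 (c S))) :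
    Ergodic T μ := by
  refine ⟨hT, ⟨fun S hS hTS => ?_⟩⟩
  have hmeas : ∀ B ∈ 𝒞, MeasurableSet B := fun B hB => by
    rw [hgen]; exact MeasurableSpace.measurableSet_generateFrom hB
  have hind : ∀ B ∈ 𝒞, μ.real (B ∩ S) = μ.real S * μ.real B := by
    intro B hB
    have h1 := setIntegral_eq_of_ae_tendsto_const hT (measurable_one.indicator (hmeas B hB))
      (abs_indicator_one_le B) (h B hB) hS hTS
    have h2 := setIntegral_eq_of_ae_tendsto_const hT (measurable_one.indicator (hmeas B hB))
      (abs_indicator_one_le B) (h B hB) MeasurableSet.univ rfl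
    simp only [Measure.restrict_univ, probReal_univ, one_mul] at h2
    rw [integral_indicator_one (hmeas B hB)] at h1 h2
    rw [measureReal_restrict_apply (hmeas B hB)] at h1
    rw [h1, h2]
  have hext : μ.restrict S = (μ S) • μ := by
    refine ext_of_generate_finite 𝒞 hgen hpi (fun B hB => ?_) (by simp)
    rw [Measure.restrict_apply (hmeas B hB), Measure.smul_apply, smul_eq_mul]
    have := hind B hB
    simp only [measureReal_def, ← ENNReal.toReal_mul] at this
    exact (ENNReal.toReal_eq_toReal_iff' (measure_ne_top _ _)
      (ENNReal.mul_ne_top (measure_ne_top _ _) (measure_ne_top _ _))).1 this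
  have hsq : μ S = μ S * μ S := by
    have := congrArg (fun m => m S) hext
    simpa using this
  rw [eventuallyConst_set']
  by_cases h0 : μ S = 0
  · left; exact ae_eq_empty.2 h0
  · right
    rw [ae_eq_univ, prob_compl_eq_zero_iff hS]
    have := (ENNReal.mul_eq_left h0 (measure_ne_top _ _)).1 hsq.symm
    exact this

end Birkhoff
/-! ### Conditioning on the invariant sets -/

section ErgodicComponents

variable {X : Type*} {m : MeasurableSpace X} [mX : MeasurableSpace X] [StandardBorelSpace X]
  {T : X → X} {μ : Measure X}

lemma lintegral_condExpKernel_apply [IsFiniteMeasure μ]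
    (hm : m ≤ mX) {S : Set X} (hS : MeasurableSet S) :
    ∫⁻ x, condExpKernel μ m x S ∂μ = μ S := by
  conv_rhs => rw [← condExpKernel_comp_trim (μ := μ) hm]
  rw [Measure.bind_apply hS (Kernel.aemeasurable _), lintegral_trim hm (Kernel.measurable_coe _ hS)]

/-- A jointly measurable property that holds on the diagonal holds for almost every point paired
with almost every point of its conditional law. -/
lemma ae_ae_condExpKernel_of_ae_diag [IsFiniteMeasure μ]
    (hm : m ≤ mX) {p : X → X → Prop}
    (hp : MeasurableSet[m.prod mX] {z : X × X | p z.1 z.2})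
    (h : ∀ᵐ x ∂μ, p x x) : ∀ᵐ x ∂μ, ∀ᵐ y ∂condExpKernel μ m x, p x y := by
  have h1 : ∀ᵐ z ∂(μ.trim hm) ⊗ₘ condExpKernel μ m, p z.1 z.2 := by
    rw [compProd_trim_condExpKernel hm]
    refine (@ae_map_iff X (X × X) _ (m.prod _) μ Function.diag ?_ _ hp).2 h
    have h2 : @Measurable X (X × X) mX (m.prod mX) Function.diag := fun s hs =>
      (measurable_id.prodMk measurable_id : @Measurable X (X × X) mX (mX.prod mX) Function.diag)
        (sup_le_sup (MeasurableSpace.comap_mono hm) le_rfl s hs)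
    exact @Measurable.aemeasurable _ _ mX (m.prod mX) _ _ h2
  exact ae_of_ae_trim hm (Measure.ae_ae_of_ae_compProd h1)

/-- The conditional law given the invariant σ-algebra is invariant on each measurable set. -/
lemma ae_condExpKernel_invariants_preimage [IsFiniteMeasure μ] (hT : MeasurePreserving T μ μ)
    {S : Set X} (hS : MeasurableSet S) :
    ∀ᵐ x ∂μ, condExpKernel μ (MeasurableSpace.invariants T) x (T ⁻¹' S) =
      condExpKernel μ (MeasurableSpace.invariants T) x S := by
  have hm := MeasurableSpace.invariants_le T
  have hTS := hT.measurable hS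
  have h1 := condExpKernel_ae_eq_condExp (μ := μ) hm hS
  have h2 := condExpKernel_ae_eq_condExp (μ := μ) hm hTS
  have h3 : μ[(T ⁻¹' S).indicator (fun _ => (1 : ℝ)) | MeasurableSpace.invariants T] =ᵐ[μ]
      μ[S.indicator (fun _ => (1 : ℝ)) | MeasurableSpace.invariants T] := by
    refine ae_eq_condExp_of_forall_setIntegral_eq hm ((integrable_const 1).indicator hS)
      (fun _ _ _ => integrable_condExp.integrableOn) (fun B hB _ => ?_)
      stronglyMeasurable_condExp.aestronglyMeasurable
    rw [setIntegral_condExp hm ((integrable_const 1).indicator hTS) hB]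
    have hB' : MeasurableSet B ∧ T ⁻¹' B = B := MeasurableSpace.measurableSet_invariants.1 hB
    rw [setIntegral_indicator hTS, setIntegral_indicator hS]
    simp only [integral_const, smul_eq_mul, mul_one, measureReal_restrict_apply_univ]
    rw [measureReal_def, measureReal_def, ← hT.measure_preimage (hB'.1.inter hS).nullMeasurableSet,
      Set.preimage_inter, hB'.2]
  filter_upwards [h1, h2, h3] with x h1 h2 h3
  rw [← measureReal_eq_measureReal_iff]
  exact h2.trans (h3.trans h1.symm)

/-- Conditioning on the invariant σ-algebra produces ergodic measures. Along the conditional law of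
`x`, visit frequencies converge to their limit at `x`, because that limit is an invariant function
and conditionally on the invariant σ-algebra such a function is constant. -/
theorem ae_ergodic_condExpKernel_invariants [IsProbabilityMeasure μ]
    (hT : MeasurePreserving T μ μ) {𝒞 : Set (Set X)} (hcount : 𝒞.Countable)
    (hgen : mX = MeasurableSpace.generateFrom 𝒞) (hpi : IsPiSystem 𝒞) :
    ∀ᵐ x ∂μ, Ergodic T (condExpKernel μ (MeasurableSpace.invariants T) x) := by
  have hm := MeasurableSpace.invariants_le T
  have hmeas : ∀ S ∈ 𝒞, MeasurableSet S := fun S hS => by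
    rw [hgen]; exact MeasurableSpace.measurableSet_generateFrom hS
  have h1 : ∀ᵐ x ∂μ, ∀ S ∈ 𝒞, condExpKernel μ (MeasurableSpace.invariants T) x (T ⁻¹' S) =
      condExpKernel μ (MeasurableSpace.invariants T) x S :=
    (ae_ball_iff hcount).2 fun S hS => ae_condExpKernel_invariants_preimage hT (hmeas S hS)
  have h2 : ∀ᵐ x ∂μ, ∀ S ∈ 𝒞, ∀ᵐ y ∂condExpKernel μ (MeasurableSpace.invariants T) x,
      Tendsto (fun n => visitFreq T S n y) atTop (𝓝 (birkhoffLimsup T (S.indicator 1) x)) := by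
    refine (ae_ball_iff hcount).2 fun S hS => ?_
    have hSm := measurable_one.indicator (β := ℝ) (hmeas S hS)
    refine ae_ae_condExpKernel_of_ae_diag hm
      (p := fun x y => Tendsto (fun n => visitFreq T S n y) atTop
        (𝓝 (birkhoffLimsup T (S.indicator 1) x))) ?_
      (ae_tendsto_birkhoffAverage hT hSm (abs_indicator_one_le S))
    have h3 : ∀ n, Measurable[(MeasurableSpace.invariants T).prod mX]
        (fun z : X × X => visitFreq T S n z.2 - birkhoffLimsup T (S.indicator 1) z.1) := fun n =>
      Measurable.sub
        ((measurable_visitFreq hT.measurable (hmeas S hS) n).comp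
          (@measurable_snd X X (MeasurableSpace.invariants T) _))
        ((measurable_invariants_birkhoffLimsup hT.measurable hSm (abs_indicator_one_le S)).comp
          (@measurable_fst X X (MeasurableSpace.invariants T) _))
    have h4 := @measurableSet_tendsto _ _ _ ((MeasurableSpace.invariants T).prod mX)
      _ _ atTop _ (𝓝 0) _ _ _ h3
    simpa only [tendsto_sub_nhds_zero_iff] using h4
  filter_upwards [h1, h2] with x hx1 hx2
  refine ergodic_of_ae_tendsto_visitFreq ⟨hT.measurable, ?_⟩ hgen hpi _ hx2
  have : IsProbabilityMeasure
      ((condExpKernel μ (MeasurableSpace.invariants T) x).map T) :=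
    Measure.isProbabilityMeasure_map hT.measurable.aemeasurable
  refine ext_of_generate_finite 𝒞 hgen hpi (fun S hS => ?_) (by simp)
  rw [Measure.map_apply hT.measurable (hmeas S hS), hx1 S hS]

end ErgodicComponents

/-! ### Words and cylinders -/

section SequenceSpace

variable {A : Type*}

/-- The first `n` letters of a sequence. -/
def initialWord (n : ℕ) (ω : ℕ → A) : Fin n → A := fun i => ω i

lemma initialWord_eq_iff {n : ℕ} {ω η : ℕ → A} :
    initialWord n η = initialWord n ω ↔ ∀ i < n, η i = ω i :=
  ⟨fun h i hi => congrFun h ⟨i, hi⟩, fun h => funext fun i => h i i.2⟩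

lemma cylinder_eq_preimage (n : ℕ) (ω : ℕ → A) :
    cylinder n ω = initialWord n ⁻¹' {initialWord n ω} := by
  ext η; exact initialWord_eq_iff.symm

lemma shift_iterate (n : ℕ) (ω : ℕ → A) : (shift A)^[n] ω = fun i => ω (n + i) := by
  induction n generalizing ω with
  | zero => simp
  | succ n ih =>
    rw [Function.iterate_succ_apply, ih]
    funext i; simp only [shift]; congr 1; omega

/-- The sets of sequences described by finitely many initial letters. -/
def initialCylinders (A : Type*) : Set (Set (ℕ → A)) :=
  Set.range fun p : Σ n : ℕ, Set (Fin n → A) => initialWord p.1 ⁻¹' p.2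

lemma countable_initialCylinders [Finite A] : (initialCylinders A).Countable :=
  Set.countable_range _

lemma isPiSystem_initialCylinders : IsPiSystem (initialCylinders A) := by
  rintro _ ⟨⟨n, B⟩, rfl⟩ _ ⟨⟨m, C⟩, rfl⟩ -
  refine ⟨⟨max n m, {w | (fun i : Fin n => w ⟨i, by omega⟩) ∈ B ∧
    (fun i : Fin m => w ⟨i, by omega⟩) ∈ C}⟩, rfl⟩

variable [MeasurableSpace A]

lemma measurable_initialWord (n : ℕ) : Measurable (initialWord (A := A) n) :=
  measurable_pi_lambda _ fun _ => measurable_pi_apply _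

lemma measurable_shift : Measurable (shift A) :=
  measurable_pi_lambda _ fun _ => measurable_pi_apply _

lemma measurableSet_of_mem_initialCylinders [Finite A] [DiscreteMeasurableSpace A]
    {S : Set (ℕ → A)} (hS : S ∈ initialCylinders A) : MeasurableSet S := by
  obtain ⟨⟨n, B⟩, rfl⟩ := hS
  exact measurable_initialWord n (Set.toFinite B).measurableSet

lemma generateFrom_initialCylinders [Finite A] [DiscreteMeasurableSpace A] :
    (inferInstance : MeasurableSpace (ℕ → A)) =
      MeasurableSpace.generateFrom (initialCylinders A) := by
  refine le_antisymm (iSup_le fun i => ?_)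
    (MeasurableSpace.generateFrom_le fun S hS => measurableSet_of_mem_initialCylinders hS)
  rintro _ ⟨B, -, rfl⟩
  exact MeasurableSpace.measurableSet_generateFrom
    ⟨⟨i + 1, {w | w ⟨i, by omega⟩ ∈ B}⟩, rfl⟩

end SequenceSpace

/-! ### Existence and uniqueness of the ergodic decomposition -/

section ErgodicDecomposition

/-- An almost sure property of the mixture is almost sure under almost every component. -/
lemma IsErgodicDecomposition.ae_ae {A : Type*} [MeasurableSpace A] {μ : Measure (ℕ → A)}
    {lam : Measure (ergodicLaws A)}
    (h : IsErgodicDecomposition μ lam) {p : (ℕ → A) → Prop} (hp : ∀ᵐ ω ∂μ, p ω) :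
    ∀ᵐ ν : ergodicLaws A ∂lam, ∀ᵐ ω ∂(ν : Measure (ℕ → A)), p ω := by
  obtain ⟨N, hsub, hN, hN0⟩ := exists_measurable_superset_of_null hp
  rw [h.mixture N hN, lintegral_eq_zero_iff (h.measurable_component N hN)] at hN0
  filter_upwards [hN0] with ν hν
  exact measure_mono_null hsub hν

variable {A : Type*} [Fintype A] [MeasurableSpace A] [DiscreteMeasurableSpace A]
  {μ : Measure (ℕ → A)}

/-- The mixing measure is the law under `μ` of the conditional distribution given the invariant
σ-algebra, which is almost surely ergodic. -/
theorem exists_isErgodicDecomposition (hμ : μ ∈ stationaryLaws A) :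
    ∃ lam : Measure (ergodicLaws A), IsErgodicDecomposition μ lam := by
  have hprob : IsProbabilityMeasure μ := hμ.1
  have hm := MeasurableSpace.invariants_le (shift A)
  set κ := condExpKernel μ (MeasurableSpace.invariants (shift A)) with hκ
  have hκm : Measurable (fun ω => κ ω) := κ.measurable.mono hm le_rfl
  have hae : ∀ᵐ ω ∂μ, κ ω ∈ ergodicLaws A := by
    filter_upwards [ae_ergodic_condExpKernel_invariants hμ.2 countable_initialCylinders
      generateFrom_initialCylinders isPiSystem_initialCylinders] with ω hω
    exact mem_ergodicLaws_iff.2 ⟨inferInstance, hω⟩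
  obtain ⟨N, hNae, hN, hNE⟩ : ∃ N : Set (ℕ → A), N ∈ ae μ ∧ MeasurableSet N ∧
      ∀ ω ∈ N, κ ω ∈ ergodicLaws A := by
    obtain ⟨N, hsub, hN, hN0⟩ := exists_measurable_superset_of_null hae
    exact ⟨Nᶜ, compl_mem_ae_iff.2 hN0, hN.compl, fun ω hω => by
      by_contra h; exact hω (hsub h)⟩
  obtain ⟨ω₀, hω₀⟩ := hae.exists
  classical
  -- Off the conull set `N` the value of the parameter map is an arbitrary ergodic law.
  let g : (ℕ → A) → ergodicLaws A := fun ω =>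
    ⟨if ω ∈ N then κ ω else κ ω₀, by split_ifs with h; exacts [hNE ω h, hω₀]⟩
  have hg : Measurable g := (hκm.ite hN measurable_const).subtype_mk
  have hgκ : ∀ᵐ ω ∂μ, (g ω : Measure (ℕ → A)) = κ ω := by
    filter_upwards [hNae] with ω hω
    simp [g, hω]
  have hval : ∀ S, MeasurableSet S → Measurable fun ν : ergodicLaws A => (ν : Measure (ℕ → A)) S :=
    fun S hS => (Measure.measurable_coe hS).comp measurable_subtype_coe
  refine ⟨μ.map g, ⟨Measure.isProbabilityMeasure_map hg.aemeasurable,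
    fun ν => (mem_ergodicLaws_iff.1 ν.2).1, hval, fun S hS => ?_⟩⟩
  rw [lintegral_map (hval S hS) hg, ← lintegral_condExpKernel_apply hm hS]
  exact lintegral_congr_ae (hgκ.mono fun ω hω => by simp only [hω, hκ])

/-- The σ-algebra on the ergodic laws is generated by their values on initial cylinders. -/
lemma measurableSpace_ergodicLaws_le_comap :
    (inferInstance : MeasurableSpace (ergodicLaws A)) ≤
      MeasurableSpace.comap (fun (ν : ergodicLaws A) (S : initialCylinders A) =>
        (ν : Measure (ℕ → A)).real S) inferInstance := by
  set e := fun (ν : ergodicLaws A) (S : initialCylinders A) => (ν : Measure (ℕ → A)).real S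
  have hprob : ∀ ν : ergodicLaws A, IsProbabilityMeasure (ν : Measure (ℕ → A)) :=
    fun ν => (mem_ergodicLaws_iff.1 ν.2).1
  have : @Measurable _ _ (MeasurableSpace.comap e inferInstance) _
      (fun ν : ergodicLaws A => (ν : Measure (ℕ → A))) := by
    let _ : MeasurableSpace (ergodicLaws A) := MeasurableSpace.comap e inferInstance
    refine Measurable.measure_of_isPiSystem_of_isProbabilityMeasure
      generateFrom_initialCylinders isPiSystem_initialCylinders fun S hS => ?_
    have he : Measurable e := comap_measurable e
    have h2 : (fun ν : ergodicLaws A => (ν : Measure (ℕ → A)) S) =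
        fun ν => ENNReal.ofReal (e ν ⟨S, hS⟩) := by
      funext ν; exact (ofReal_measureReal).symm
    rw [h2]
    exact ((measurable_pi_apply _).comp he).ennreal_ofReal
  exact this.comap_le

/-- The mixing measure is the `μ`-law of the limiting visit frequencies of the initial cylinders:
almost surely under an ergodic law these frequencies are the values of that law. -/
theorem IsErgodicDecomposition.unique {lam lam' : Measure (ergodicLaws A)}
    (h : IsErgodicDecomposition μ lam) (h' : IsErgodicDecomposition μ lam') : lam = lam' := by
  set e := fun (ν : ergodicLaws A) (S : initialCylinders A) => (ν : Measure (ℕ → A)).real S with he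
  let G := fun (ω : ℕ → A) (S : initialCylinders A) =>
    birkhoffLimsup (shift A) ((S : Set (ℕ → A)).indicator 1) ω
  have hcount : Countable (initialCylinders A) := countable_initialCylinders.to_subtype
  have hG : Measurable G := measurable_pi_lambda _ fun S =>
    measurable_birkhoffLimsup measurable_shift
      (measurable_one.indicator (measurableSet_of_mem_initialCylinders S.2))
  have hGe : ∀ ν : ergodicLaws A, ∀ᵐ ω ∂(ν : Measure (ℕ → A)), G ω = e ν := by
    intro ν
    obtain ⟨hprob, herg⟩ := mem_ergodicLaws_iff.1 ν.2
    have : ∀ᵐ ω ∂(ν : Measure (ℕ → A)), ∀ S : initialCylinders A, G ω S = e ν S :=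
      ae_all_iff.2 fun S => (herg.ae_tendsto_visitFreq
        (measurableSet_of_mem_initialCylinders S.2)).mono fun ω hω => hω.limsup_eq
    exact this.mono fun ω hω => funext hω
  have key : ∀ l : Measure (ergodicLaws A), IsErgodicDecomposition μ l →
      ∀ D, MeasurableSet D → l (e ⁻¹' D) = μ (G ⁻¹' D) := by
    intro l hl D hD
    have hem : Measurable e := measurable_pi_lambda _ fun S =>
      (hl.measurable_component S (measurableSet_of_mem_initialCylinders S.2)).ennreal_toReal
    rw [hl.mixture _ (hG hD), ← lintegral_indicator_one (hem hD)]
    refine lintegral_congr fun ν => ?_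
    have hprob : IsProbabilityMeasure (ν : Measure (ℕ → A)) := (mem_ergodicLaws_iff.1 ν.2).1
    by_cases hν : e ν ∈ D
    · rw [Set.indicator_of_mem (by exact hν), Pi.one_apply, eq_comm,
        ← mem_ae_iff_prob_eq_one (hG hD)]
      filter_upwards [hGe ν] with ω hω
      rwa [Set.mem_preimage, hω]
    · rw [Set.indicator_of_notMem (by exact hν), eq_comm, measure_eq_zero_iff_ae_notMem]
      filter_upwards [hGe ν] with ω hω
      rwa [Set.mem_preimage, hω]
  refine Measure.ext fun B hB => ?_
  obtain ⟨D, hD, rfl⟩ := measurableSpace_ergodicLaws_le_comap B hB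
  exact (key lam h D hD).trans (key lam' h' D hD).symm

end ErgodicDecomposition
/-! ### Predictions and Doob's maximal inequality -/

section Prediction

variable {X : Type*} [mX : MeasurableSpace X] {P : Measure X}

/-- `Y` is a prediction of `V` from the information `𝒢`: a `[0, 1]`-valued, everywhere defined
version of the conditional expectation of `V` given `𝒢`, characterized by testing against bounded
`𝒢`-measurable functions. -/
structure IsPrediction (P : Measure X) (𝒢 : MeasurableSpace X) (V Y : X → ℝ) : Prop where
  measurable : Measurable[𝒢] Y
  nonneg : ∀ x, 0 ≤ Y x
  le_one : ∀ x, Y x ≤ 1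
  integral_mul_eq : ∀ (Z : X → ℝ) (C : ℝ), Measurable[𝒢] Z → (∀ x, |Z x| ≤ C) →
    ∫ x, Z x * Y x ∂P = ∫ x, Z x * V x ∂P

lemma integrable_mul_of_abs_le [IsFiniteMeasure P] {f g : X → ℝ} (hf : Measurable f)
    (hg : Measurable g) {C D : ℝ} (hC : ∀ x, |f x| ≤ C) (hD : ∀ x, |g x| ≤ D) :
    Integrable (fun x => f x * g x) P := by
  refine integrable_of_abs_le (C := C * D) (hf.mul hg) fun x => ?_
  rw [abs_mul]
  exact mul_le_mul (hC x) (hD x) (abs_nonneg _) ((abs_nonneg _).trans (hC x))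

lemma integrable_sq_of_abs_le [IsFiniteMeasure P] {f : X → ℝ} (hf : Measurable f) {C : ℝ}
    (hC : ∀ x, |f x| ≤ C) : Integrable (fun x => f x ^ 2) P := by
  simpa only [sq] using integrable_mul_of_abs_le hf hf hC hC

end Prediction

section PredictionLemmas

variable {X : Type*} {𝒢 𝒢' : MeasurableSpace X} [mX : MeasurableSpace X] {P : Measure X}

namespace IsPrediction

variable {V Y Y' : X → ℝ}

lemma abs_le_one (h : IsPrediction P 𝒢 V Y) (x : X) : |Y x| ≤ 1 :=
  abs_le.2 ⟨by linarith [h.nonneg x], h.le_one x⟩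

lemma integral_sq (h : IsPrediction P 𝒢 V Y) : ∫ x, Y x ^ 2 ∂P = ∫ x, Y x * V x ∂P := by
  simpa only [sq] using h.integral_mul_eq Y 1 h.measurable h.abs_le_one

variable [IsFiniteMeasure P]

/-- Pythagoras: refining the information from `𝒢` to `𝒢'` moves the prediction by the increase of
its second moment. -/
lemma integral_sub_sq (h : IsPrediction P 𝒢 V Y) (h' : IsPrediction P 𝒢' V Y') (hle : 𝒢 ≤ 𝒢')
    (hm' : 𝒢' ≤ mX) :
    ∫ x, (Y' x - Y x) ^ 2 ∂P = ∫ x, Y' x ^ 2 ∂P - ∫ x, Y x ^ 2 ∂P := by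
  have hY : Measurable Y := h.measurable.mono (hle.trans hm') le_rfl
  have hY' : Measurable Y' := h'.measurable.mono hm' le_rfl
  have h1 : ∫ x, Y x * Y' x ∂P = ∫ x, Y x ^ 2 ∂P := by
    rw [h.integral_sq, h'.integral_mul_eq Y 1 (h.measurable.mono hle le_rfl) h.abs_le_one]
  have i1 : Integrable (fun x => Y x * Y' x) P :=
    integrable_mul_of_abs_le hY hY' h.abs_le_one h'.abs_le_one
  have i2 : Integrable (fun x => Y x ^ 2) P :=
    integrable_sq_of_abs_le hY h.abs_le_one
  have i3 : Integrable (fun x => Y' x ^ 2) P :=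
    integrable_sq_of_abs_le hY' h'.abs_le_one
  have e : (fun x => (Y' x - Y x) ^ 2) = fun x => (Y' x ^ 2 + Y x ^ 2) - 2 * (Y x * Y' x) := by
    funext x; ring
  have i4 : Integrable (fun x => Y' x ^ 2 + Y x ^ 2) P := i3.add i2
  rw [e, integral_sub i4 (i1.const_mul 2), integral_add i3 i2, integral_const_mul, h1]
  ring

lemma integral_sq_mono (h : IsPrediction P 𝒢 V Y) (h' : IsPrediction P 𝒢' V Y') (hle : 𝒢 ≤ 𝒢')
    (hm' : 𝒢' ≤ mX) : ∫ x, Y x ^ 2 ∂P ≤ ∫ x, Y' x ^ 2 ∂P := by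
  have h1 := h.integral_sub_sq h' hle hm'
  have h2 : 0 ≤ ∫ x, (Y' x - Y x) ^ 2 ∂P := integral_nonneg fun x => sq_nonneg _
  linarith

/-- The prediction minimizes the mean square error, in the form in which the second moment of `V`
has been cancelled. -/
lemma integral_le_integral_sq (h : IsPrediction P 𝒢 V Y) (hm : 𝒢 ≤ mX) (hV : Measurable V)
    (hV1 : ∀ x, |V x| ≤ 1) {Z : X → ℝ} (hZ : Measurable[𝒢] Z) (hZ1 : ∀ x, |Z x| ≤ 1) :
    ∫ x, (2 * (Z x * V x) - Z x ^ 2) ∂P ≤ ∫ x, Y x ^ 2 ∂P := by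
  have hY : Measurable Y := h.measurable.mono hm le_rfl
  have hZm : Measurable Z := hZ.mono hm le_rfl
  have i1 : Integrable (fun x => Z x * V x) P :=
    integrable_mul_of_abs_le hZm hV hZ1 hV1
  have i2 : Integrable (fun x => Z x * Y x) P :=
    integrable_mul_of_abs_le hZm hY hZ1 h.abs_le_one
  have i3 : Integrable (fun x => Z x ^ 2) P :=
    integrable_sq_of_abs_le hZm hZ1
  have i4 : Integrable (fun x => Y x ^ 2) P :=
    integrable_sq_of_abs_le hY h.abs_le_one
  have e : ∫ x, (2 * (Z x * V x) - Z x ^ 2) ∂P = ∫ x, (2 * (Z x * Y x) - Z x ^ 2) ∂P := by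
    rw [integral_sub (i1.const_mul 2) i3, integral_sub (i2.const_mul 2) i3, integral_const_mul,
      integral_const_mul, h.integral_mul_eq Z 1 hZ hZ1]
  rw [e]
  refine integral_mono ((i2.const_mul 2).sub i3) i4 fun x => ?_
  dsimp only
  nlinarith [sq_nonneg (Y x - Z x)]

end IsPrediction

lemma measureReal_le_abs_sub_le [IsFiniteMeasure P] {f : X → ℝ} (hf : Measurable f) {C : ℝ}
    (hC : ∀ x, |f x| ≤ C) {δ : ℝ} (hδ : 0 < δ) :
    P.real {x | δ ≤ |f x|} ≤ (∫ x, f x ^ 2 ∂P) / δ ^ 2 := by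
  have hi : Integrable (fun x => f x ^ 2) P :=
    integrable_sq_of_abs_le hf hC
  have h1 := mul_meas_ge_le_integral_of_nonneg (ae_of_all P fun x => sq_nonneg (f x)) hi (δ ^ 2)
  have e : {x | δ ^ 2 ≤ f x ^ 2} = {x | δ ≤ |f x|} := by
    ext x
    simp only [Set.mem_ofPred_eq]
    rw [← sq_abs (f x)]
    exact pow_le_pow_iff_left₀ hδ.le (abs_nonneg _) two_ne_zero
  rw [e] at h1
  rw [le_div_iff₀ (by positivity)]
  linarith

/-- Doob's maximal inequality for the predictions of a fixed `V` from increasing information,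
with finite horizon `L`. The event is split according to the first time `k` at which the prediction
has moved by `δ` since time `m`. -/
theorem measureReal_exists_le_abs_prediction_sub_le [IsFiniteMeasure P]
    {𝒢 : ℕ → MeasurableSpace X} {V : X → ℝ} {Y : ℕ → X → ℝ} {m L : ℕ} (hmL : m ≤ L)
    (hle : ∀ k, 𝒢 k ≤ mX) (hmono : ∀ j k, j ≤ k → k ≤ L → 𝒢 j ≤ 𝒢 k)
    (hY : ∀ k ≤ L, IsPrediction P (𝒢 k) V (Y k)) {δ : ℝ} (hδ : 0 < δ) :
    P.real {x | ∃ k, m ≤ k ∧ k ≤ L ∧ δ ≤ |Y k x - Y m x|} ≤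
      (∫ x, Y L x ^ 2 ∂P - ∫ x, Y m x ^ 2 ∂P) / δ ^ 2 := by
  let B : ℕ → Set X := fun k =>
    {x | δ ≤ |Y k x - Y m x|} ∩ ⋂ j ∈ Finset.Ico m k, {x | δ ≤ |Y j x - Y m x|}ᶜ
  have hYm : ∀ j k, j ≤ k → k ≤ L → Measurable[𝒢 k] (Y j) := fun j k hjk hkL =>
    (hY j (hjk.trans hkL)).measurable.mono (hmono j k hjk hkL) le_rfl
  have hlevel : ∀ j k, m ≤ k → j ≤ k → k ≤ L → MeasurableSet[𝒢 k] {x | δ ≤ |Y j x - Y m x|} := by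
    intro j k hmk hjk hkL
    have : Measurable[𝒢 k] fun x => |Y j x - Y m x| :=
      measurable_norm.comp ((hYm j k hjk hkL).sub (hYm m k hmk hkL))
    exact this measurableSet_Ici
  have hB : ∀ k, m ≤ k → k ≤ L → MeasurableSet[𝒢 k] (B k) := by
    intro k hmk hkL
    refine @MeasurableSet.inter X (𝒢 k) _ _ (hlevel k k hmk le_rfl hkL) ?_
    refine @Finset.measurableSet_biInter X ℕ (𝒢 k) _ _ fun j hj => ?_
    exact (hlevel j k hmk (Finset.mem_Ico.1 hj).2.le hkL).compl
  have hdisj : ∀ x, ∀ j ∈ Finset.Icc m L, ∀ k ∈ Finset.Icc m L, x ∈ B j → x ∈ B k → j = k := by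
    have aux : ∀ x, ∀ j k, m ≤ j → j < k → x ∈ B j → x ∉ B k := by
      intro x j k hj hjk hxj hxk
      have := Set.mem_iInter₂.1 hxk.2 j (Finset.mem_Ico.2 ⟨hj, hjk⟩)
      exact this hxj.1
    intro x j hj k hk hxj hxk
    rcases lt_trichotomy j k with h | h | h
    · exact absurd hxk (aux x j k (Finset.mem_Icc.1 hj).1 h hxj)
    · exact h
    · exact absurd hxj (aux x k j (Finset.mem_Icc.1 hk).1 h hxk)
  have hcover : {x | ∃ k, m ≤ k ∧ k ≤ L ∧ δ ≤ |Y k x - Y m x|} ⊆ ⋃ k ∈ Finset.Icc m L, B k := by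
    intro x hx
    classical
    have hfind := Nat.find_spec hx
    refine Set.mem_iUnion₂.2 ⟨Nat.find hx, Finset.mem_Icc.2 ⟨hfind.1, hfind.2.1⟩, hfind.2.2, ?_⟩
    refine Set.mem_iInter₂.2 fun j hj hxj => ?_
    have hj' := Finset.mem_Ico.1 hj
    exact Nat.find_min hx hj'.2 ⟨hj'.1, hj'.2.le.trans hfind.2.1, hxj⟩
  -- The cross term on `B k`, whose first factor is known at time `k`.
  let U : ℕ → X → ℝ := fun k => (B k).indicator fun x => Y k x - Y m x
  have hU : ∀ k, m ≤ k → k ≤ L → Measurable[𝒢 k] (U k) := fun k hmk hkL =>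
    ((hYm k k le_rfl hkL).sub (hYm m k hmk hkL)).indicator (hB k hmk hkL)
  have hU2 : ∀ k, m ≤ k → k ≤ L → ∀ x, |U k x| ≤ 2 := by
    intro k hmk hkL x
    by_cases hx : x ∈ B k
    · simp only [U, Set.indicator_of_mem hx]
      have := abs_le.1 ((hY k hkL).abs_le_one x)
      have := abs_le.1 ((hY m hmL).abs_le_one x)
      rw [abs_le]; constructor <;> linarith
    · simp [U, Set.indicator_of_notMem hx]
  have hYm' : ∀ k ≤ L, Measurable (Y k) := fun k hk => (hY k hk).measurable.mono (hle k) le_rfl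
  have hUm' : ∀ k, m ≤ k → k ≤ L → Measurable (U k) := fun k hmk hkL =>
    (hU k hmk hkL).mono (hle k) le_rfl
  have hUi : ∀ k, m ≤ k → k ≤ L → ∀ j ≤ L, Integrable (fun x => U k x * Y j x) P :=
    fun k hmk hkL j hj => integrable_mul_of_abs_le (hUm' k hmk hkL) (hYm' j hj)
      (hU2 k hmk hkL) (hY j hj).abs_le_one
  -- The increment after time `k` is orthogonal to everything known at time `k`.
  have hcross : ∀ k, m ≤ k → k ≤ L → ∫ x, U k x * (Y L x - Y k x) ∂P = 0 := by
    intro k hmk hkL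
    simp only [mul_sub]
    rw [integral_sub (hUi k hmk hkL L le_rfl) (hUi k hmk hkL k hkL),
      (hY L le_rfl).integral_mul_eq (U k) 2 ((hU k hmk hkL).mono (hmono k L hkL le_rfl) le_rfl)
        (hU2 k hmk hkL), (hY k hkL).integral_mul_eq (U k) 2 (hU k hmk hkL) (hU2 k hmk hkL),
      sub_self]
  -- On `B k` expand the square of `Y L - Y m = (Y k - Y m) + (Y L - Y k)`.
  have hpt : ∀ x, ∑ k ∈ Finset.Icc m L,
      ((B k).indicator (fun _ => δ ^ 2) x + 2 * (U k x * (Y L x - Y k x))) ≤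
        (Y L x - Y m x) ^ 2 := by
    intro x
    by_cases hx : ∃ k ∈ Finset.Icc m L, x ∈ B k
    · obtain ⟨k, hk, hxk⟩ := hx
      rw [Finset.sum_eq_single_of_mem k hk]
      · simp only [U, Set.indicator_of_mem hxk]
        have h1 : δ ^ 2 ≤ (Y k x - Y m x) ^ 2 := by
          rw [← sq_abs (Y k x - Y m x)]
          exact pow_le_pow_left₀ hδ.le hxk.1 2
        nlinarith [sq_nonneg (Y L x - Y k x)]
      · intro j hj hjk
        have : x ∉ B j := fun hxj => hjk (hdisj x j hj k hk hxj hxk)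
        simp [U, Set.indicator_of_notMem this]
    · push Not at hx
      rw [Finset.sum_eq_zero]
      · positivity
      · intro j hj
        simp [U, Set.indicator_of_notMem (hx j hj)]
  have hBm : ∀ k ∈ Finset.Icc m L, MeasurableSet (B k) := fun k hk =>
    hle k _ (hB k (Finset.mem_Icc.1 hk).1 (Finset.mem_Icc.1 hk).2)
  have hint1 : ∀ k ∈ Finset.Icc m L, Integrable (fun x => (B k).indicator (fun _ => δ ^ 2) x) P :=
    fun k hk => (integrable_const _).indicator (hBm k hk)
  have hint2 : ∀ k ∈ Finset.Icc m L,
      Integrable (fun x => 2 * (U k x * (Y L x - Y k x))) P := by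
    intro k hk
    have hk' := Finset.mem_Icc.1 hk
    simp only [mul_sub (U k _)]
    exact ((hUi k hk'.1 hk'.2 L le_rfl).sub (hUi k hk'.1 hk'.2 k hk'.2)).const_mul 2
  have hint3 : ∀ k ∈ Finset.Icc m L, Integrable (fun x =>
      (B k).indicator (fun _ => δ ^ 2) x + 2 * (U k x * (Y L x - Y k x))) P :=
    fun k hk => (hint1 k hk).add (hint2 k hk)
  have hsum : ∑ k ∈ Finset.Icc m L, P.real (B k) * δ ^ 2 ≤ ∫ x, (Y L x - Y m x) ^ 2 ∂P := by
    have h1 := integral_mono (integrable_finsetSum _ hint3)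
      (?_ : Integrable (fun x => (Y L x - Y m x) ^ 2) P) hpt
    · rw [integral_finsetSum _ hint3] at h1
      refine le_trans (le_of_eq (Finset.sum_congr rfl fun k hk => ?_)) h1
      have hk' := Finset.mem_Icc.1 hk
      rw [integral_add (hint1 k hk) (hint2 k hk), integral_const_mul, hcross k hk'.1 hk'.2,
        integral_indicator (hBm k hk), setIntegral_const, smul_eq_mul]
      ring
    · have hb : ∀ x, |Y L x - Y m x| ≤ 2 := fun x => by
        have := abs_le.1 ((hY L le_rfl).abs_le_one x)
        have := abs_le.1 ((hY m hmL).abs_le_one x)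
        rw [abs_le]; constructor <;> linarith
      have hm2 : Measurable fun x => Y L x - Y m x := (hYm' L le_rfl).sub (hYm' m hmL)
      exact integrable_sq_of_abs_le hm2 hb
  rw [le_div_iff₀ (by positivity),
    ← (hY m hmL).integral_sub_sq (hY L le_rfl) (hmono m L hmL le_rfl) (hle L)]
  refine le_trans ?_ hsum
  rw [← Finset.sum_mul]
  refine mul_le_mul_of_nonneg_right ?_ (by positivity)
  exact (measureReal_mono hcover (measure_ne_top _ _)).trans (measureReal_biUnion_finset_le _ _)

end PredictionLemmas
/-! ### Predictive probabilities of stationary laws -/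

section PredictiveProbabilities

variable {A : Type*}

/-- The indicator of the event that the letter at time `n` is `a`. -/
noncomputable def letterIndicator (a : A) (n : ℕ) (ω : ℕ → A) : ℝ :=
  {η : ℕ → A | η n = a}.indicator 1 ω

lemma abs_letterIndicator_le (a : A) (n : ℕ) (ω : ℕ → A) : |letterIndicator a n ω| ≤ 1 :=
  abs_indicator_one_le _ _

lemma letterIndicator_shift (a : A) {k L : ℕ} (hk : k ≤ L) (ω : ℕ → A) :
    letterIndicator a k ((shift A)^[L - k] ω) = letterIndicator a L ω := by
  have h : (shift A)^[L - k] ω k = ω L := by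
    simp only [shift_iterate, Nat.sub_add_cancel hk]
  by_cases hL : ω L = a <;> simp [letterIndicator, h, hL]

/-- The word of length `k` that ends just before time `L`. -/
def pastWord (L k : ℕ) (ω : ℕ → A) : Fin k → A := initialWord k ((shift A)^[L - k] ω)

lemma pastWord_self (L : ℕ) (ω : ℕ → A) : pastWord L L ω = initialWord L ω := by
  simp [pastWord]

lemma pastWord_eq_comp {j k L : ℕ} (hjk : j ≤ k) (hkL : k ≤ L) (ω : ℕ → A) :
    pastWord L j ω = fun i : Fin j => pastWord L k ω ⟨k - j + i, by omega⟩ := by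
  funext i
  simp only [pastWord, initialWord, shift_iterate]
  congr 1; omega

variable [MeasurableSpace A]

lemma measurable_pastWord (L k : ℕ) : Measurable (pastWord (A := A) L k) :=
  (measurable_initialWord k).comp (measurable_shift.iterate _)

/-- The predictive probability of the letter `a` as a function of the word observed so far. -/
noncomputable def wordPredictive (ν : Measure (ℕ → A)) (n : ℕ) (w : Fin n → A) (a : A) : ℝ :=
  (ν[|initialWord n ⁻¹' {w}]).real {η | η n = a}

lemma predictive_eq_wordPredictive (ν : Measure (ℕ → A)) (n : ℕ) (ω : ℕ → A) (a : A) :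
    predictive ν n ω a = wordPredictive ν n (initialWord n ω) a := by
  rw [predictive, cylinder_eq_preimage, wordPredictive]

lemma wordPredictive_nonneg (ν : Measure (ℕ → A)) (n : ℕ) (w : Fin n → A) (a : A) :
    0 ≤ wordPredictive ν n w a := measureReal_nonneg

lemma wordPredictive_le_one (ν : Measure (ℕ → A)) (n : ℕ) (w : Fin n → A) (a : A) :
    wordPredictive ν n w a ≤ 1 := measureReal_le_one

lemma abs_predictive_le_one (ν : Measure (ℕ → A)) (n : ℕ) (ω : ℕ → A) (a : A) :
    |predictive ν n ω a| ≤ 1 := by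
  rw [predictive_eq_wordPredictive, abs_of_nonneg (wordPredictive_nonneg _ _ _ _)]
  exact wordPredictive_le_one _ _ _ _

variable [Finite A] [DiscreteMeasurableSpace A]

lemma measurableSet_initialWord_preimage (n : ℕ) (w : Fin n → A) :
    MeasurableSet (initialWord n ⁻¹' {w} : Set (ℕ → A)) :=
  measurable_initialWord n (measurableSet_singleton w)

lemma measurableSet_letter (n : ℕ) (a : A) : MeasurableSet {η : ℕ → A | η n = a} :=
  (measurable_pi_apply n : Measurable fun η : ℕ → A => η n) (measurableSet_singleton a)

lemma wordPredictive_eq_div (ν : Measure (ℕ → A)) (n : ℕ) (w : Fin n → A) (a : A) :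
    wordPredictive ν n w a =
      ν.real (initialWord n ⁻¹' {w} ∩ {η | η n = a}) / ν.real (initialWord n ⁻¹' {w}) := by
  rw [wordPredictive, measureReal_def, cond_apply (measurableSet_initialWord_preimage n w),
    ENNReal.toReal_mul, ENNReal.toReal_inv, div_eq_inv_mul]
  rfl

lemma measureReal_mul_wordPredictive (ν : Measure (ℕ → A)) [IsFiniteMeasure ν] (n : ℕ)
    (w : Fin n → A) (a : A) :
    ν.real (initialWord n ⁻¹' {w}) * wordPredictive ν n w a =
      ν.real (initialWord n ⁻¹' {w} ∩ {η | η n = a}) := by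
  rw [wordPredictive_eq_div]
  by_cases h : ν.real (initialWord n ⁻¹' {w}) = 0
  · have : ν.real (initialWord n ⁻¹' {w} ∩ {η | η n = a}) = 0 :=
      le_antisymm ((measureReal_mono Set.inter_subset_left).trans h.le) measureReal_nonneg
    rw [h, this, zero_mul]
  · field_simp

lemma measurable_letterIndicator (a : A) (n : ℕ) : Measurable (letterIndicator a n) :=
  measurable_one.indicator (measurableSet_letter n a)

lemma measurable_of_initialWord {n : ℕ} (f : (Fin n → A) → ℝ) : Measurable f :=
  measurable_of_finite f

lemma integral_initialWord_mul_indicator (ν : Measure (ℕ → A)) [IsFiniteMeasure ν]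
    [Fintype A] {n : ℕ} (f : (Fin n → A) → ℝ) {B : Set (ℕ → A)} (hB : MeasurableSet B) :
    ∫ ω, f (initialWord n ω) * B.indicator 1 ω ∂ν =
      ∑ w, f w * ν.real (initialWord n ⁻¹' {w} ∩ B) := by
  have hm : ∀ w : Fin n → A, MeasurableSet (initialWord n ⁻¹' {w} ∩ B) := fun w =>
    (measurableSet_initialWord_preimage n w).inter hB
  have e : (fun ω => f (initialWord n ω) * B.indicator 1 ω) =
      fun ω => ∑ w, f w * (initialWord n ⁻¹' {w} ∩ B).indicator 1 ω := by
    funext ω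
    rw [Finset.sum_eq_single (initialWord n ω)]
    · by_cases hω : ω ∈ B <;> simp [Set.indicator, hω]
    · intro w _ hw
      rw [Set.indicator_of_notMem (fun h => hw (by simpa using h.1.symm)), mul_zero]
    · simp
  have hi : ∀ w ∈ Finset.univ,
      Integrable (fun ω => f w * (initialWord n ⁻¹' {w} ∩ B).indicator 1 ω) ν := fun w _ =>
    ((integrable_const (1 : ℝ)).indicator (hm w)).const_mul (f w)
  rw [e, integral_finsetSum _ hi]
  exact Finset.sum_congr rfl fun w _ => by rw [integral_const_mul, integral_indicator_one (hm w)]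

/-- The defining property of the predictive probability as a conditional expectation. -/
lemma integral_mul_predictive (ν : Measure (ℕ → A)) [IsFiniteMeasure ν] {n : ℕ}
    (f : (Fin n → A) → ℝ) (a : A) :
    ∫ ω, f (initialWord n ω) * predictive ν n ω a ∂ν =
      ∫ ω, f (initialWord n ω) * letterIndicator a n ω ∂ν := by
  have := Fintype.ofFinite A
  have e : (fun ω => f (initialWord n ω) * predictive ν n ω a) =
      fun ω => (fun w => f w * wordPredictive ν n w a) (initialWord n ω) *
        Set.univ.indicator 1 ω := by
    funext ω; simp [predictive_eq_wordPredictive]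
  rw [e, integral_initialWord_mul_indicator ν (fun w => f w * wordPredictive ν n w a)
    MeasurableSet.univ]
  unfold letterIndicator
  rw [integral_initialWord_mul_indicator ν _ (measurableSet_letter n a)]
  refine Finset.sum_congr rfl fun w _ => ?_
  rw [Set.inter_univ, ← measureReal_mul_wordPredictive]; ring

/-- For a stationary law the predictive probabilities, read along words that end at time `L`, are
conditional expectations of one and the same indicator. -/
lemma integral_mul_predictive_shift {ν : Measure (ℕ → A)} [IsFiniteMeasure ν]
    (hν : MeasurePreserving (shift A) ν ν) {k L : ℕ} (hk : k ≤ L) (f : (Fin k → A) → ℝ) (a : A) :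
    ∫ ω, f (pastWord L k ω) * predictive ν k ((shift A)^[L - k] ω) a ∂ν =
      ∫ ω, f (pastWord L k ω) * letterIndicator a L ω ∂ν := by
  have hS := hν.iterate (L - k)
  have hmp : Measurable fun ω => f (initialWord k ω) * predictive ν k ω a := by
    simp only [predictive_eq_wordPredictive]
    exact (measurable_of_initialWord fun w => f w * wordPredictive ν k w a).comp
      (measurable_initialWord k)
  have hml : Measurable fun ω => f (initialWord k ω) * letterIndicator a k ω :=
    ((measurable_of_initialWord f).comp (measurable_initialWord k)).mul
      (measurable_letterIndicator a k)
  have key := integral_mul_predictive ν f a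
  rw [← hS.integral_comp_of_aestronglyMeasurable hmp.aestronglyMeasurable,
    ← hS.integral_comp_of_aestronglyMeasurable hml.aestronglyMeasurable] at key
  simpa only [letterIndicator_shift a hk, pastWord] using key

end PredictiveProbabilities

/-! ### The joint law of component and sequence -/

section Joint

variable {A : Type*} [MeasurableSpace A] {Θ : Type*} [MeasurableSpace Θ]

/-- The shift acting on the second coordinate of pairs of a parameter and a sequence. -/
def fiberShift (Θ A : Type*) : Θ × (ℕ → A) → Θ × (ℕ → A) := Prod.map id (shift A)

lemma fiberShift_iterate {Θ A : Type*} (n : ℕ) (z : Θ × (ℕ → A)) :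
    (fiberShift Θ A)^[n] z = (z.1, (shift A)^[n] z.2) := by
  rw [fiberShift, Prod.map_iterate, Function.iterate_id]; rfl

lemma measurable_fiberShift : Measurable (fiberShift Θ A) :=
  measurable_id.prodMap measurable_shift

variable {lam : Measure Θ} {K : Kernel Θ (ℕ → A)} {μ : Measure (ℕ → A)}

lemma measurePreserving_fiberShift [SFinite lam] [IsSFiniteKernel K]
    (hK : ∀ θ, MeasurePreserving (shift A) (K θ) (K θ)) :
    MeasurePreserving (fiberShift Θ A) (lam ⊗ₘ K) (lam ⊗ₘ K) := by
  refine ⟨measurable_fiberShift, Measure.ext fun s hs => ?_⟩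
  rw [Measure.map_apply measurable_fiberShift hs, Measure.compProd_apply hs,
    Measure.compProd_apply (measurable_fiberShift hs)]
  refine lintegral_congr fun θ => ?_
  exact (hK θ).measure_preimage (measurable_prodMk_left hs).nullMeasurableSet

/-- The information of an observer who has seen the `k` letters before time `L`. -/
abbrev pastAlgebra (Θ A : Type*) [MeasurableSpace A] (L k : ℕ) : MeasurableSpace (Θ × (ℕ → A)) :=
  MeasurableSpace.comap (fun z => pastWord L k z.2) inferInstance

/-- The information of an observer who knows the parameter and has seen the `k` letters before
time `L`. -/
abbrev informedPastAlgebra (Θ A : Type*) [MeasurableSpace Θ] [MeasurableSpace A] (L k : ℕ) :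
    MeasurableSpace (Θ × (ℕ → A)) :=
  MeasurableSpace.comap (fun z => (z.1, pastWord L k z.2)) inferInstance

lemma measurable_pastWord_snd (L k : ℕ) :
    Measurable fun z : Θ × (ℕ → A) => pastWord L k z.2 :=
  (measurable_initialWord k).comp ((measurable_shift.iterate _).comp measurable_snd)

lemma pastAlgebra_le (L k : ℕ) : pastAlgebra Θ A L k ≤ Prod.instMeasurableSpace :=
  (measurable_pastWord_snd L k).comap_le

lemma informedPastAlgebra_le (L k : ℕ) :
    informedPastAlgebra Θ A L k ≤ Prod.instMeasurableSpace :=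
  (measurable_fst.prodMk (measurable_pastWord_snd L k)).comap_le

lemma pastAlgebra_le_informedPastAlgebra (L k : ℕ) :
    pastAlgebra Θ A L k ≤ informedPastAlgebra Θ A L k := by
  have h : Measurable[informedPastAlgebra Θ A L k] fun z : Θ × (ℕ → A) => pastWord L k z.2 :=
    measurable_snd.comp (comap_measurable fun z : Θ × (ℕ → A) => (z.1, pastWord L k z.2))
  exact h.comap_le

lemma measurable_subword {j k : ℕ} (hjk : j ≤ k) :
    Measurable fun (w : Fin k → A) (i : Fin j) => w ⟨k - j + i, by omega⟩ :=
  measurable_pi_lambda _ fun _ => measurable_pi_apply _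

lemma pastAlgebra_mono {Θ : Type*} {j k L : ℕ} (hjk : j ≤ k) (hkL : k ≤ L) :
    pastAlgebra Θ A L j ≤ pastAlgebra Θ A L k := by
  have h : Measurable[pastAlgebra Θ A L k] fun z : Θ × (ℕ → A) => pastWord L j z.2 := by
    rw [funext fun z : Θ × (ℕ → A) => pastWord_eq_comp hjk hkL z.2]
    exact (measurable_subword hjk).comp (comap_measurable fun z : Θ × (ℕ → A) => pastWord L k z.2)
  exact h.comap_le

lemma informedPastAlgebra_mono {j k L : ℕ} (hjk : j ≤ k) (hkL : k ≤ L) :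
    informedPastAlgebra Θ A L j ≤ informedPastAlgebra Θ A L k := by
  have h : Measurable[informedPastAlgebra Θ A L k]
      fun z : Θ × (ℕ → A) => (z.1, pastWord L j z.2) := by
    rw [funext fun z : Θ × (ℕ → A) => congrArg (Prod.mk z.1) (pastWord_eq_comp hjk hkL z.2)]
    exact (measurable_id.prodMap (measurable_subword hjk)).comp
      (comap_measurable fun z : Θ × (ℕ → A) => (z.1, pastWord L k z.2))
  exact h.comap_le

variable [Finite A] [DiscreteMeasurableSpace A]

lemma measurable_predictive (ν : Measure (ℕ → A)) (n : ℕ) (a : A) :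
    Measurable fun ω => predictive ν n ω a := by
  simp only [predictive_eq_wordPredictive]
  exact (measurable_of_initialWord fun w => wordPredictive ν n w a).comp (measurable_initialWord n)

lemma measurable_wordPredictive_kernel (K : Kernel Θ (ℕ → A)) (n : ℕ) (a : A) :
    Measurable fun p : Θ × (Fin n → A) => wordPredictive (K p.1) n p.2 a := by
  refine measurable_from_prod_countable_left fun w => ?_
  simp only [wordPredictive_eq_div]
  exact (K.measurable_coe ((measurableSet_initialWord_preimage n w).inter
      (measurableSet_letter n a))).ennreal_toReal.div
    (K.measurable_coe (measurableSet_initialWord_preimage n w)).ennreal_toReal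

lemma measurable_predictive_kernel (K : Kernel Θ (ℕ → A)) (n : ℕ) (a : A) :
    Measurable fun z : Θ × (ℕ → A) => predictive (K z.1) n z.2 a := by
  have h : Measurable fun z : Θ × (ℕ → A) => (z.1, initialWord n z.2) :=
    measurable_fst.prodMk ((measurable_initialWord n).comp measurable_snd)
  have h' := (measurable_wordPredictive_kernel K n a).comp h
  simpa only [Function.comp_def, predictive_eq_wordPredictive] using h'

/-- The predictive probabilities of the mixture, as predictions under the joint law. -/
theorem isPrediction_predictive [IsFiniteMeasure μ]
    (hμ : MeasurePreserving (shift A) μ μ)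
    (hsnd : MeasurePreserving Prod.snd (lam ⊗ₘ K) μ) {k L : ℕ} (hk : k ≤ L) (a : A) :
    IsPrediction (lam ⊗ₘ K) (pastAlgebra Θ A L k) (fun z => letterIndicator a L z.2)
      (fun z => predictive μ k ((shift A)^[L - k] z.2) a) := by
  refine ⟨?_, fun z => measureReal_nonneg, fun z => measureReal_le_one, fun Z C hZ hC => ?_⟩
  · simp only [predictive_eq_wordPredictive]
    exact (measurable_of_initialWord fun w => wordPredictive μ k w a).comp
      (comap_measurable fun z : Θ × (ℕ → A) => pastWord L k z.2)
  · obtain ⟨f, -, rfl⟩ := hZ.exists_eq_measurable_comp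
    have h1 : Measurable fun ω => f (pastWord L k ω) * predictive μ k ((shift A)^[L - k] ω) a :=
      ((measurable_of_initialWord f).comp (measurable_pastWord L k)).mul
        ((measurable_predictive μ k a).comp (measurable_shift.iterate _))
    have h2 : Measurable fun ω => f (pastWord L k ω) * letterIndicator a L ω :=
      ((measurable_of_initialWord f).comp (measurable_pastWord L k)).mul
        (measurable_letterIndicator a L)
    have key := integral_mul_predictive_shift hμ hk f a
    rw [← hsnd.integral_comp_of_aestronglyMeasurable h1.aestronglyMeasurable,
      ← hsnd.integral_comp_of_aestronglyMeasurable h2.aestronglyMeasurable] at key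
    exact key

/-- The predictive probabilities of the components are the predictions under the joint law of an
observer who knows the component. -/
theorem isPrediction_predictive_kernel [IsFiniteMeasure lam] [IsMarkovKernel K]
    (hK : ∀ θ, MeasurePreserving (shift A) (K θ) (K θ)) {k L : ℕ} (hk : k ≤ L) (a : A) :
    IsPrediction (lam ⊗ₘ K) (informedPastAlgebra Θ A L k) (fun z => letterIndicator a L z.2)
      (fun z => predictive (K z.1) k ((shift A)^[L - k] z.2) a) := by
  refine ⟨?_, fun z => measureReal_nonneg, fun z => measureReal_le_one, fun Z C hZ hC => ?_⟩
  · have h := (measurable_wordPredictive_kernel K k a).comp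
      (comap_measurable fun z : Θ × (ℕ → A) => (z.1, pastWord L k z.2))
    simpa only [Function.comp_def, predictive_eq_wordPredictive, pastWord] using h
  · have hZm : Measurable Z := hZ.mono (informedPastAlgebra_le L k) le_rfl
    have hS : Measurable fun z : Θ × (ℕ → A) => (z.1, (shift A)^[L - k] z.2) :=
      measurable_fst.prodMk ((measurable_shift.iterate _).comp measurable_snd)
    have hp := (measurable_predictive_kernel K k a).comp hS
    simp only [Function.comp_def] at hp
    have i1 : Integrable (fun z => Z z * predictive (K z.1) k ((shift A)^[L - k] z.2) a)
        (lam ⊗ₘ K) := integrable_mul_of_abs_le hZm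
      hp hC
      fun z => abs_predictive_le_one _ _ _ _
    have i2 : Integrable (fun z => Z z * letterIndicator a L z.2) (lam ⊗ₘ K) :=
      integrable_mul_of_abs_le hZm ((measurable_letterIndicator a L).comp measurable_snd) hC
        fun z => abs_letterIndicator_le _ _ _
    rw [Measure.integral_compProd i1, Measure.integral_compProd i2]
    obtain ⟨f, -, rfl⟩ := hZ.exists_eq_measurable_comp
    exact integral_congr_ae (ae_of_all _ fun θ =>
      integral_mul_predictive_shift (hK θ) hk (fun w => f (θ, w)) a)

end Joint
/-! ### Empirical prediction -/

section EmpiricalPrediction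

variable {X : Type*} {T : X → X}

lemma visitFreq_nonneg (S : Set X) (n : ℕ) (x : X) : 0 ≤ visitFreq T S n x := by
  rw [visitFreq, birkhoffAverage, smul_eq_mul]
  exact mul_nonneg (by positivity)
    (Finset.sum_nonneg fun i _ => Set.indicator_nonneg (fun _ _ => zero_le_one) _)

lemma visitFreq_mono {S S' : Set X} (h : S ⊆ S') (n : ℕ) (x : X) :
    visitFreq T S n x ≤ visitFreq T S' n x := by
  simp only [visitFreq, birkhoffAverage, smul_eq_mul]
  refine mul_le_mul_of_nonneg_left ?_ (by positivity)
  exact Finset.sum_le_sum fun i _ =>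
    Set.indicator_le_indicator_of_subset h (fun _ => zero_le_one) _

lemma ae_visitFreq_eq_zero [MeasurableSpace X] {ν : Measure X} (hT : MeasurePreserving T ν ν)
    {S : Set X} (hS : ν S = 0) : ∀ᵐ x ∂ν, ∀ n, visitFreq T S n x = 0 := by
  have h : ∀ᵐ x ∂ν, ∀ i, T^[i] x ∉ S := ae_all_iff.2 fun i =>
    (hT.iterate i).quasiMeasurePreserving.ae (measure_eq_zero_iff_ae_notMem.1 hS)
  filter_upwards [h] with x hx n
  rw [visitFreq, birkhoffAverage, birkhoffSum,
    Finset.sum_eq_zero fun i _ => Set.indicator_of_notMem (hx i) _, smul_zero]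

variable {A : Type*}

/-- The prediction of the letter `a` after the word `w` by the frequency with which `w` has been
followed by `a` at the times before `n`. -/
noncomputable def empiricalPredictive (a : A) {m : ℕ} (n : ℕ) (w : Fin m → A) (ω : ℕ → A) : ℝ :=
  visitFreq (shift A) (initialWord m ⁻¹' {w} ∩ {η | η m = a}) n ω /
    visitFreq (shift A) (initialWord m ⁻¹' {w}) n ω

lemma empiricalPredictive_nonneg (a : A) {m : ℕ} (n : ℕ) (w : Fin m → A) (ω : ℕ → A) :
    0 ≤ empiricalPredictive a n w ω :=
  div_nonneg (visitFreq_nonneg _ _ _) (visitFreq_nonneg _ _ _)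

lemma empiricalPredictive_le_one (a : A) {m : ℕ} (n : ℕ) (w : Fin m → A) (ω : ℕ → A) :
    empiricalPredictive a n w ω ≤ 1 :=
  div_le_one_of_le₀ (visitFreq_mono Set.inter_subset_left _ _) (visitFreq_nonneg _ _ _)

lemma visitFreq_congr {S : Set (ℕ → A)} {j n : ℕ}
    (hS : ∀ ω η : ℕ → A, (∀ i < j, ω i = η i) → (ω ∈ S ↔ η ∈ S)) {ω η : ℕ → A}
    (h : ∀ i < n + j, ω i = η i) : visitFreq (shift A) S n ω = visitFreq (shift A) S n η := by
  simp only [visitFreq, birkhoffAverage, birkhoffSum]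
  congr 1
  refine Finset.sum_congr rfl fun i hi => ?_
  have hi' := Finset.mem_range.1 hi
  have : (shift A)^[i] ω ∈ S ↔ (shift A)^[i] η ∈ S := hS _ _ fun l hl => by
    simp only [shift_iterate]; exact h _ (by omega)
  by_cases hω : (shift A)^[i] ω ∈ S
  · simp [hω, this.1 hω]
  · rw [Set.indicator_of_notMem hω, Set.indicator_of_notMem fun h => hω (this.2 h)]

/-- The empirical predictions with sample size `n` for words of length `m` use only the first
`n + (m + 1)` letters. -/
lemma empiricalPredictive_congr (a : A) {m n : ℕ} (w : Fin m → A) {ω η : ℕ → A}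
    (h : ∀ i < n + (m + 1), ω i = η i) :
    empiricalPredictive a n w ω = empiricalPredictive a n w η := by
  have hw : ∀ ω η : ℕ → A, (∀ i < m + 1, ω i = η i) →
      (ω ∈ initialWord m ⁻¹' {w} ↔ η ∈ initialWord m ⁻¹' {w}) := by
    intro ω η h
    have : initialWord m ω = initialWord m η := initialWord_eq_iff.2 fun i hi => h i (by omega)
    simp [this]
  have hwa : ∀ ω η : ℕ → A, (∀ i < m + 1, ω i = η i) →
      (ω ∈ initialWord m ⁻¹' {w} ∩ {η | η m = a} ↔
        η ∈ initialWord m ⁻¹' {w} ∩ {η | η m = a}) := by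
    intro ω η h
    simp only [Set.mem_inter_iff, hw ω η h, Set.mem_ofPred_eq, h m (by omega)]
  rw [empiricalPredictive, empiricalPredictive, visitFreq_congr hw h, visitFreq_congr hwa h]

variable [MeasurableSpace A] [Finite A] [DiscreteMeasurableSpace A]

lemma measurable_empiricalPredictive (a : A) {m : ℕ} (n : ℕ) (w : Fin m → A) :
    Measurable (empiricalPredictive a n w) :=
  (measurable_visitFreq measurable_shift
      ((measurableSet_initialWord_preimage m w).inter (measurableSet_letter m a)) n).div
    (measurable_visitFreq measurable_shift (measurableSet_initialWord_preimage m w) n)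

/-- Under an ergodic law the empirical predictions are consistent. This includes words of
probability zero: they are never seen, and both predictions are then `0 / 0 = 0`. -/
lemma ae_tendsto_empiricalPredictive {ν : Measure (ℕ → A)} [IsProbabilityMeasure ν]
    (hν : Ergodic (shift A) ν) (a : A) (m : ℕ) :
    ∀ᵐ ω ∂ν, ∀ w : Fin m → A,
      Tendsto (fun n => empiricalPredictive a n w ω) atTop (𝓝 (wordPredictive ν m w a)) := by
  refine ae_all_iff.2 fun w => ?_
  have hW := measurableSet_initialWord_preimage m w
  by_cases h0 : ν.real (initialWord m ⁻¹' {w}) = 0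
  · filter_upwards [ae_visitFreq_eq_zero hν.toMeasurePreserving
      ((measureReal_eq_zero_iff).1 h0)] with ω hω
    simp only [empiricalPredictive, wordPredictive_eq_div, hω, h0, div_zero]
    exact tendsto_const_nhds
  · filter_upwards [hν.ae_tendsto_visitFreq hW,
      hν.ae_tendsto_visitFreq (hW.inter (measurableSet_letter m a))] with ω h1 h2
    rw [wordPredictive_eq_div]
    exact h2.div h1 h0

end EmpiricalPrediction

/-! ### The value of knowing the component -/

section Recovery

variable {A : Type*} [MeasurableSpace A] [Fintype A]
  {Θ : Type*} [MeasurableSpace Θ] {lam : Measure Θ} {K : Kernel Θ (ℕ → A)} {μ : Measure (ℕ → A)}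

/-- The total error of the empirical predictions with sample size `n` for words of length `m`. -/
noncomputable def empiricalError (K : Kernel Θ (ℕ → A)) (a : A) (m n : ℕ) (z : Θ × (ℕ → A)) : ℝ :=
  ∑ w : Fin m → A, |empiricalPredictive a n w z.2 - wordPredictive (K z.1) m w a|

lemma abs_sub_le_one_of_mem {x y : ℝ} (hx : 0 ≤ x) (hx' : x ≤ 1) (hy : 0 ≤ y) (hy' : y ≤ 1) :
    |x - y| ≤ 1 := abs_le.2 ⟨by linarith, by linarith⟩

lemma abs_empiricalError_le (a : A) (m n : ℕ) (z : Θ × (ℕ → A)) :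
    |empiricalError K a m n z| ≤ Fintype.card (Fin m → A) := by
  rw [empiricalError, abs_of_nonneg (Finset.sum_nonneg fun _ _ => abs_nonneg _)]
  refine (Finset.sum_le_card_nsmul _ _ 1 fun w _ => abs_sub_le_one_of_mem
    (empiricalPredictive_nonneg _ _ _ _) (empiricalPredictive_le_one _ _ _ _)
    (wordPredictive_nonneg _ _ _ _) (wordPredictive_le_one _ _ _ _)).trans ?_
  simp

variable [DiscreteMeasurableSpace A]

lemma measurable_empiricalError (a : A) (m n : ℕ) : Measurable (empiricalError K a m n) := by
  unfold empiricalError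
  refine Finset.measurable_fun_sum _ fun w _ => ?_
  have h1 : Measurable fun z : Θ × (ℕ → A) => wordPredictive (K z.1) m w a := by
    have := (measurable_wordPredictive_kernel K m a).comp
      (measurable_fst.prodMk measurable_const : Measurable fun z : Θ × (ℕ → A) => (z.1, w))
    simpa only [Function.comp_def] using this
  exact measurable_norm.comp
    (((measurable_empiricalPredictive a n w).comp measurable_snd).sub h1)

lemma tendsto_integral_empiricalError [IsFiniteMeasure lam] [IsMarkovKernel K]
    (hK : ∀ θ, Ergodic (shift A) (K θ)) (a : A) (m : ℕ) :
    Tendsto (fun n => ∫ z, empiricalError K a m n z ∂(lam ⊗ₘ K)) atTop (𝓝 0) := by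
  have h : ∀ᵐ z ∂(lam ⊗ₘ K), Tendsto (fun n => empiricalError K a m n z) atTop (𝓝 0) := by
    refine Measure.ae_compProd_of_ae_ae
      (measurableSet_tendsto _ fun n => measurable_empiricalError a m n) (ae_of_all _ fun θ => ?_)
    filter_upwards [ae_tendsto_empiricalPredictive (hK θ) a m] with ω hω
    have : Tendsto (fun n => ∑ w : Fin m → A,
        |empiricalPredictive a n w ω - wordPredictive (K θ) m w a|) atTop
        (𝓝 (∑ _w : Fin m → A, 0)) := by
      refine tendsto_finsetSum _ fun w _ => ?_
      have := ((hω w).sub_const (wordPredictive (K θ) m w a)).abs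
      simpa using this
    rw [Finset.sum_const_zero] at this
    exact this
  have := tendsto_integral_of_dominated_convergence (μ := lam ⊗ₘ K)
    (fun _ => (Fintype.card (Fin m → A) : ℝ))
    (fun n => (measurable_empiricalError (K := K) a m n).aestronglyMeasurable)
    (integrable_const _) (fun n => ae_of_all _ fun z => abs_empiricalError_le a m n z) h
  simpa using this

/-- Knowing the ergodic component does not improve the quality of prediction in the limit: the
second moments of the informed predictions are bounded by the supremum of those of the predictions
from the past alone. For the component enters the prediction after a given word only through its
predictive probability, a function invariant under the shift and hence approximated equally well by
empirical predictions made in the remote past. -/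
theorem integral_sq_predictive_kernel_le [IsFiniteMeasure lam] [IsMarkovKernel K]
    [IsFiniteMeasure μ] (hK : ∀ θ, Ergodic (shift A) (K θ))
    (hμ : MeasurePreserving (shift A) μ μ)
    (hsnd : MeasurePreserving Prod.snd (lam ⊗ₘ K) μ) (a : A) {c : ℝ}
    (hc : ∀ k, ∫ ω, predictive μ k ω a ^ 2 ∂μ ≤ c) (m : ℕ) :
    ∫ z, predictive (K z.1) m z.2 a ^ 2 ∂(lam ⊗ₘ K) ≤ c := by
  have hK' := fun θ => (hK θ).toMeasurePreserving
  have key : ∀ n, ∫ z, predictive (K z.1) m z.2 a ^ 2 ∂(lam ⊗ₘ K) ≤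
      c + 2 * ∫ z, empiricalError K a m n z ∂(lam ⊗ₘ K) := by
    intro n
    -- The empirical prediction with sample size `n` reads the letters before `L`, and it is used
    -- to predict the letter at time `L`.
    obtain ⟨L, hL⟩ : ∃ L, L = n + (m + 1) := ⟨_, rfl⟩
    have hmL : m ≤ L := by omega
    set V : Θ × (ℕ → A) → ℝ := fun z => letterIndicator a L z.2 with hV
    set Y : Θ × (ℕ → A) → ℝ := fun z => predictive μ L ((shift A)^[L - L] z.2) a with hYdef
    set Y' : Θ × (ℕ → A) → ℝ := fun z => predictive (K z.1) m ((shift A)^[L - m] z.2) a with hY'def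
    set Z : Θ × (ℕ → A) → ℝ := fun z => empiricalPredictive a n (pastWord L m z.2) z.2 with hZdef
    have hY := isPrediction_predictive hμ hsnd (le_refl L) a
    have hY' := isPrediction_predictive_kernel (lam := lam) hK' hmL a
    have hVm : Measurable V := (measurable_letterIndicator a L).comp measurable_snd
    have hV1 : ∀ z, |V z| ≤ 1 := fun z => abs_letterIndicator_le _ _ _
    have hZ0 : ∀ z, 0 ≤ Z z := fun z => empiricalPredictive_nonneg _ _ _ _
    have hZ1 : ∀ z, Z z ≤ 1 := fun z => empiricalPredictive_le_one _ _ _ _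
    have hZabs : ∀ z, |Z z| ≤ 1 := fun z => abs_le.2 ⟨by linarith [hZ0 z], hZ1 z⟩
    have hZmeas : Measurable[pastAlgebra Θ A L L] Z := by
      have hfac : Function.FactorsThrough
          (fun ω : ℕ → A => empiricalPredictive a n (pastWord L m ω) ω) (pastWord L L) := by
        intro ω η h
        have h1 : pastWord L m ω = pastWord L m η := by
          rw [pastWord_eq_comp hmL le_rfl ω, pastWord_eq_comp hmL le_rfl η, h]
        have h2 : ∀ i < n + (m + 1), ω i = η i := by
          rw [pastWord_self, pastWord_self, initialWord_eq_iff] at h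
          rwa [← hL]
        simp only [h1]
        exact empiricalPredictive_congr a _ h2
      have hext : Z = Function.extend (pastWord L L)
          (fun ω : ℕ → A => empiricalPredictive a n (pastWord L m ω) ω) 0 ∘
            fun z => pastWord L L z.2 := by
        funext z
        exact (hfac.extend_apply 0 z.2).symm
      rw [hext]
      exact (measurable_of_initialWord _).comp
        (comap_measurable fun z : Θ × (ℕ → A) => pastWord L L z.2)
    have hZm : Measurable Z := hZmeas.mono (pastAlgebra_le L L) le_rfl
    have hY'm : Measurable Y' := hY'.measurable.mono (informedPastAlgebra_le L m) le_rfl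
    have hclose : ∀ z, |Z z - Y' z| ≤ empiricalError K a m n z := by
      intro z
      have e : Y' z = wordPredictive (K z.1) m (pastWord L m z.2) a :=
        predictive_eq_wordPredictive _ _ _ _
      rw [e]
      exact Finset.single_le_sum (f := fun w : Fin m → A =>
        |empiricalPredictive a n w z.2 - wordPredictive (K z.1) m w a|)
        (fun _ _ => abs_nonneg _) (Finset.mem_univ (pastWord L m z.2))
    -- With `V`, `Y'`, `Z` in `[0, 1]`, the function `y ↦ 2yV - y²` is 2-Lipschitz.
    have hpt : ∀ z, 2 * (Y' z * V z) - Y' z ^ 2 ≤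
        (2 * (Z z * V z) - Z z ^ 2) + 2 * empiricalError K a m n z := by
      intro z
      have h1 : |(Y' z - Z z) * (2 * V z - Y' z - Z z)| ≤ empiricalError K a m n z * 2 := by
        rw [abs_mul]
        have hV0 : 0 ≤ V z := Set.indicator_nonneg (fun _ _ => zero_le_one) _
        have hV1' := (abs_le.1 (hV1 z)).2
        have := hY'.nonneg z
        have := hY'.le_one z
        have := hZ0 z
        have := hZ1 z
        refine mul_le_mul ((abs_sub_comm _ _).trans_le (hclose z)) ?_ (abs_nonneg _)
          ((abs_nonneg _).trans (hclose z))
        rw [abs_le]; constructor <;> linarith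
      have := (abs_le.1 h1).2
      nlinarith
    have iZV : Integrable (fun z => Z z * V z) (lam ⊗ₘ K) :=
      integrable_mul_of_abs_le hZm hVm hZabs hV1
    have iYV : Integrable (fun z => Y' z * V z) (lam ⊗ₘ K) :=
      integrable_mul_of_abs_le hY'm hVm hY'.abs_le_one hV1
    have iZ : Integrable (fun z => Z z ^ 2) (lam ⊗ₘ K) := integrable_sq_of_abs_le hZm hZabs
    have iY : Integrable (fun z => Y' z ^ 2) (lam ⊗ₘ K) :=
      integrable_sq_of_abs_le hY'm hY'.abs_le_one
    have iD : Integrable (fun z => empiricalError K a m n z) (lam ⊗ₘ K) :=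
      integrable_of_abs_le (measurable_empiricalError a m n) (abs_empiricalError_le a m n)
    have i1 : Integrable (fun z => 2 * (Z z * V z) - Z z ^ 2) (lam ⊗ₘ K) :=
      (iZV.const_mul 2).sub iZ
    have i2 : Integrable (fun z => 2 * (Y' z * V z) - Y' z ^ 2) (lam ⊗ₘ K) :=
      (iYV.const_mul 2).sub iY
    have e1 : ∫ z, predictive (K z.1) m z.2 a ^ 2 ∂(lam ⊗ₘ K) = ∫ z, Y' z ^ 2 ∂(lam ⊗ₘ K) := by
      have h := ((measurePreserving_fiberShift (lam := lam)
        hK').iterate (L - m)).integral_comp_of_aestronglyMeasurable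
        ((measurable_predictive_kernel K m a).pow_const 2).aestronglyMeasurable
      simp only [fiberShift_iterate] at h
      exact h.symm
    have e2 : ∫ z, Y z ^ 2 ∂(lam ⊗ₘ K) = ∫ ω, predictive μ L ω a ^ 2 ∂μ := by
      have h := hsnd.integral_comp_of_aestronglyMeasurable
        ((measurable_predictive μ L a).pow_const 2).aestronglyMeasurable
      simpa [hYdef] using h
    have e3 : ∫ z, Y' z ^ 2 ∂(lam ⊗ₘ K) = ∫ z, (2 * (Y' z * V z) - Y' z ^ 2) ∂(lam ⊗ₘ K) := by
      rw [integral_sub (iYV.const_mul 2) iY, integral_const_mul, ← hY'.integral_sq]; ring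
    calc ∫ z, predictive (K z.1) m z.2 a ^ 2 ∂(lam ⊗ₘ K)
        = ∫ z, (2 * (Y' z * V z) - Y' z ^ 2) ∂(lam ⊗ₘ K) := e1.trans e3
      _ ≤ ∫ z, ((2 * (Z z * V z) - Z z ^ 2) + 2 * empiricalError K a m n z) ∂(lam ⊗ₘ K) :=
          integral_mono i2 (i1.add (iD.const_mul 2)) hpt
      _ = ∫ z, (2 * (Z z * V z) - Z z ^ 2) ∂(lam ⊗ₘ K) +
            2 * ∫ z, empiricalError K a m n z ∂(lam ⊗ₘ K) := by
          rw [integral_add i1 (iD.const_mul 2), integral_const_mul]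
      _ ≤ c + 2 * ∫ z, empiricalError K a m n z ∂(lam ⊗ₘ K) := by
          gcongr
          exact (hY.integral_le_integral_sq (pastAlgebra_le L L) hVm hV1 hZmeas hZabs).trans
            (e2.trans_le (hc L))
  have hlim := ((tendsto_integral_empiricalError (lam := lam) hK a m).const_mul 2).const_add c
  simp only [mul_zero, add_zero] at hlim
  exact ge_of_tendsto' hlim key

end Recovery
/-! ### Cesàro merging of predictions -/

section Merging

variable {A : Type*} [MeasurableSpace A] {Θ : Type*} [MeasurableSpace Θ]
  {lam : Measure Θ} {K : Kernel Θ (ℕ → A)} {μ : Measure (ℕ → A)}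

/-- The gap between the predictive probabilities of `a` under the mixture and under the component
with the given parameter. -/
noncomputable def predictionGap (μ : Measure (ℕ → A)) (K : Kernel Θ (ℕ → A)) (a : A) (n : ℕ)
    (z : Θ × (ℕ → A)) : ℝ :=
  |predictive μ n z.2 a - predictive (K z.1) n z.2 a|

lemma predictionGap_nonneg (a : A) (n : ℕ) (z : Θ × (ℕ → A)) : 0 ≤ predictionGap μ K a n z :=
  abs_nonneg _

lemma predictionGap_le_one (a : A) (n : ℕ) (z : Θ × (ℕ → A)) : predictionGap μ K a n z ≤ 1 :=
  abs_sub_le_one_of_mem measureReal_nonneg measureReal_le_one measureReal_nonneg measureReal_le_one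

variable [Finite A] [DiscreteMeasurableSpace A]

lemma measurable_predictionGap (a : A) (n : ℕ) : Measurable (predictionGap μ K a n) :=
  measurable_norm.comp (((measurable_predictive μ n a).comp measurable_snd).sub
    (measurable_predictive_kernel K n a))

lemma integral_sq_shift_predictive [IsFiniteMeasure μ] (hμ : MeasurePreserving (shift A) μ μ)
    (hsnd : MeasurePreserving Prod.snd (lam ⊗ₘ K) μ) (a : A) (k j : ℕ) :
    ∫ z, predictive μ k ((shift A)^[j] z.2) a ^ 2 ∂(lam ⊗ₘ K) =
      ∫ ω, predictive μ k ω a ^ 2 ∂μ :=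
  ((hμ.iterate j).comp hsnd).integral_comp_of_aestronglyMeasurable
    ((measurable_predictive μ k a).pow_const 2).aestronglyMeasurable

lemma integral_sq_shift_predictive_kernel [SFinite lam] [IsMarkovKernel K]
    (hK : ∀ θ, MeasurePreserving (shift A) (K θ) (K θ)) (a : A) (k j : ℕ) :
    ∫ z, predictive (K z.1) k ((shift A)^[j] z.2) a ^ 2 ∂(lam ⊗ₘ K) =
      ∫ z, predictive (K z.1) k z.2 a ^ 2 ∂(lam ⊗ₘ K) := by
  have h := ((measurePreserving_fiberShift (lam := lam)
    hK).iterate j).integral_comp_of_aestronglyMeasurable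
    ((measurable_predictive_kernel K k a).pow_const 2).aestronglyMeasurable
  simpa only [fiberShift_iterate] using h

/-- The largest prediction gap over pasts of length between `m` and `L` is small with high
probability, uniformly in `L`: both predictions have moved little since length `m`, by Doob's
inequality, and at length `m` they are close in mean square. -/
lemma measureReal_exists_le_predictionGap_le [IsFiniteMeasure lam] [IsMarkovKernel K]
    [IsFiniteMeasure μ] (hK : ∀ θ, Ergodic (shift A) (K θ))
    (hμ : MeasurePreserving (shift A) μ μ)
    (hsnd : MeasurePreserving Prod.snd (lam ⊗ₘ K) μ) (a : A) {c : ℝ}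
    (hc : ∀ k, ∫ ω, predictive μ k ω a ^ 2 ∂μ ≤ c) {m L : ℕ} (hmL : m ≤ L) {δ : ℝ} (hδ : 0 < δ) :
    (lam ⊗ₘ K).real {z | ∃ k, m ≤ k ∧ k ≤ L ∧
        3 * δ ≤ predictionGap μ K a k ((fiberShift Θ A)^[L - k] z)} ≤
      3 * ((c - ∫ ω, predictive μ m ω a ^ 2 ∂μ) / δ ^ 2) := by
  have := Fintype.ofFinite A
  have hK' := fun θ => (hK θ).toMeasurePreserving
  set P := lam ⊗ₘ K
  let Y : ℕ → Θ × (ℕ → A) → ℝ := fun k z => predictive μ k ((shift A)^[L - k] z.2) a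
  let Y' : ℕ → Θ × (ℕ → A) → ℝ := fun k z => predictive (K z.1) k ((shift A)^[L - k] z.2) a
  have hY : ∀ k ≤ L, IsPrediction P (pastAlgebra Θ A L k) (fun z => letterIndicator a L z.2)
    (Y k) := fun k hk => isPrediction_predictive hμ hsnd hk a
  have hY' : ∀ k ≤ L, IsPrediction P (informedPastAlgebra Θ A L k)
    (fun z => letterIndicator a L z.2) (Y' k) := fun k hk => isPrediction_predictive_kernel hK' hk a
  have eY : ∀ k, ∫ z, Y k z ^ 2 ∂P = ∫ ω, predictive μ k ω a ^ 2 ∂μ := fun k =>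
    integral_sq_shift_predictive hμ hsnd a k _
  have eY' : ∀ k, ∫ z, Y' k z ^ 2 ∂P ≤ c := fun k =>
    (integral_sq_shift_predictive_kernel hK' a k _).trans_le
      (integral_sq_predictive_kernel_le hK hμ hsnd a hc k)
  have hpyth := (hY m hmL).integral_sub_sq (hY' m hmL) (pastAlgebra_le_informedPastAlgebra L m)
    (informedPastAlgebra_le L m)
  have hmono := (hY m hmL).integral_sq_mono (hY' m hmL) (pastAlgebra_le_informedPastAlgebra L m)
    (informedPastAlgebra_le L m)
  have hδ2 : 0 < δ ^ 2 := by positivity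
  have b1 : P.real {z | δ ≤ |Y' m z - Y m z|} ≤
      (c - ∫ ω, predictive μ m ω a ^ 2 ∂μ) / δ ^ 2 := by
    refine (measureReal_le_abs_sub_le (C := 1)
      (((hY' m hmL).measurable.mono (informedPastAlgebra_le L m) le_rfl).sub
        ((hY m hmL).measurable.mono (pastAlgebra_le L m) le_rfl))
      (fun z => abs_sub_le_one_of_mem ((hY' m hmL).nonneg z) ((hY' m hmL).le_one z)
        ((hY m hmL).nonneg z) ((hY m hmL).le_one z)) hδ).trans ?_
    simp only [Pi.sub_apply]
    rw [hpyth, eY]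
    gcongr
    exact eY' m
  have b2 : P.real {z | ∃ k, m ≤ k ∧ k ≤ L ∧ δ ≤ |Y k z - Y m z|} ≤
      (c - ∫ ω, predictive μ m ω a ^ 2 ∂μ) / δ ^ 2 := by
    refine (measureReal_exists_le_abs_prediction_sub_le hmL (fun k => pastAlgebra_le L k)
      (fun j k => pastAlgebra_mono) hY hδ).trans ?_
    rw [eY, eY]
    gcongr
    exact hc L
  have b3 : P.real {z | ∃ k, m ≤ k ∧ k ≤ L ∧ δ ≤ |Y' k z - Y' m z|} ≤
      (c - ∫ ω, predictive μ m ω a ^ 2 ∂μ) / δ ^ 2 := by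
    refine (measureReal_exists_le_abs_prediction_sub_le hmL (fun k => informedPastAlgebra_le L k)
      (fun j k => informedPastAlgebra_mono) hY' hδ).trans ?_
    rw [← eY]
    gcongr
    exact eY' L
  have hsub : {z | ∃ k, m ≤ k ∧ k ≤ L ∧
      3 * δ ≤ predictionGap μ K a k ((fiberShift Θ A)^[L - k] z)} ⊆
      ({z | δ ≤ |Y' m z - Y m z|} ∪ {z | ∃ k, m ≤ k ∧ k ≤ L ∧ δ ≤ |Y k z - Y m z|}) ∪
        {z | ∃ k, m ≤ k ∧ k ≤ L ∧ δ ≤ |Y' k z - Y' m z|} := by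
    rintro z ⟨k, hmk, hkL, hz⟩
    by_contra hno
    simp only [Set.mem_union, Set.mem_ofPred_eq, not_or, not_exists, not_and, not_le] at hno
    obtain ⟨⟨h1, h2⟩, h3⟩ := hno
    have h2' := h2 k hmk hkL
    have h3' := h3 k hmk hkL
    have h4 : predictionGap μ K a k ((fiberShift Θ A)^[L - k] z) = |Y k z - Y' k z| := by
      rw [fiberShift_iterate]; rfl
    rw [h4] at hz
    have h5 : |Y k z - Y' k z| < 3 * δ := by
      rw [abs_lt] at h1 h2' h3' ⊢
      constructor <;> linarith [h1.1, h1.2, h2'.1, h2'.2, h3'.1, h3'.2]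
    linarith
  refine (measureReal_mono hsub (measure_ne_top _ _)).trans ((measureReal_union_le _ _).trans ?_)
  linarith [measureReal_union_le (μ := P) {z | δ ≤ |Y' m z - Y m z|}
    {z | ∃ k, m ≤ k ∧ k ≤ L ∧ δ ≤ |Y k z - Y m z|}]

/-- The maximal ergodic inequality for sums of prediction gaps. Started `L` steps later, a gap with
a past of length `n ≤ L` is dominated by the largest gap over pasts of length up to `L` ending at
the same time, and these form a stationary sequence. -/
lemma measureReal_exists_lt_sum_predictionGap_le [IsProbabilityMeasure lam] [IsMarkovKernel K]
    [IsFiniteMeasure μ] (hK : ∀ θ, Ergodic (shift A) (K θ))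
    (hμ : MeasurePreserving (shift A) μ μ)
    (hsnd : MeasurePreserving Prod.snd (lam ⊗ₘ K) μ) (a : A) {c : ℝ}
    (hc : ∀ k, ∫ ω, predictive μ k ω a ^ 2 ∂μ ≤ c) {m L : ℕ} (hmL : m ≤ L) {δ : ℝ} (hδ : 0 < δ)
    {ε : ℝ} (hε : 0 < ε) :
    (lam ⊗ₘ K).real {z | ∃ N ≤ L, ε * N < ∑ n ∈ Finset.Ico m N, predictionGap μ K a n z} ≤
      (3 * δ + 3 * ((c - ∫ ω, predictive μ m ω a ^ 2 ∂μ) / δ ^ 2)) / ε := by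
  have hT := measurePreserving_fiberShift (lam := lam) fun θ => (hK θ).toMeasurePreserving
  set P := lam ⊗ₘ K
  set B := {z | ∃ k, m ≤ k ∧ k ≤ L ∧
    3 * δ ≤ predictionGap μ K a k ((fiberShift Θ A)^[L - k] z)} with hBdef
  have hB : MeasurableSet B := by
    have : B = ⋃ k ∈ Finset.Icc m L,
        {z | 3 * δ ≤ predictionGap μ K a k ((fiberShift Θ A)^[L - k] z)} := by
      ext z
      simp only [hBdef, Set.mem_ofPred_eq, Set.mem_iUnion, Finset.mem_Icc, exists_prop, and_assoc]
    rw [this]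
    exact Finset.measurableSet_biUnion _ fun k _ => measurableSet_le measurable_const
      ((measurable_predictionGap a k).comp (hT.measurable.iterate _))
  let G : Θ × (ℕ → A) → ℝ := fun z => 3 * δ + B.indicator 1 z
  have hBi : Integrable (B.indicator (1 : Θ × (ℕ → A) → ℝ)) P :=
    (integrable_const (1 : ℝ)).indicator hB
  have hG : Measurable G := measurable_const.add (measurable_one.indicator hB)
  have hGi : Integrable G P := (integrable_const _).add hBi
  have hind : ∀ z, 0 ≤ B.indicator (1 : Θ × (ℕ → A) → ℝ) z := fun z =>
    Set.indicator_nonneg (fun _ _ => zero_le_one) _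
  have hG0 : ∀ z, 0 ≤ G z := fun z => add_nonneg (by positivity) (hind z)
  have hGint : ∫ z, G z ∂P = 3 * δ + P.real B := by
    rw [integral_add (integrable_const _) hBi, integral_indicator_one hB]
    simp
  -- The first `n` letters from time `L` on are a past of time `L + n`, hence one of the pasts of
  -- time `L` of the sequence shifted by `n`; the event `B` refers to the latter.
  have hdom : ∀ n z, m ≤ n → n ≤ L →
      predictionGap μ K a n ((fiberShift Θ A)^[L] z) ≤ G ((fiberShift Θ A)^[n] z) := by
    intro n z hmn hnL
    have e : (fiberShift Θ A)^[L] z = (fiberShift Θ A)^[L - n] ((fiberShift Θ A)^[n] z) := by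
      rw [← Function.iterate_add_apply, Nat.sub_add_cancel hnL]
    rw [e]
    by_cases h : 3 * δ ≤
        predictionGap μ K a n ((fiberShift Θ A)^[L - n] ((fiberShift Θ A)^[n] z))
    · have hz : (fiberShift Θ A)^[n] z ∈ B := ⟨n, hmn, hnL, h⟩
      simp only [G, Set.indicator_of_mem hz, Pi.one_apply]
      have := predictionGap_le_one (μ := μ) (K := K) a n
        ((fiberShift Θ A)^[L - n] ((fiberShift Θ A)^[n] z))
      linarith
    · have := hind ((fiberShift Θ A)^[n] z)
      simp only [G]
      linarith [not_le.1 h]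
  have hsub : (fiberShift Θ A)^[L] ⁻¹'
      {z | ∃ N ≤ L, ε * N < ∑ n ∈ Finset.Ico m N, predictionGap μ K a n z} ⊆
      {z | ∃ N ≤ L, ε * N < birkhoffSum (fiberShift Θ A) G N z} := by
    rintro z ⟨N, hN, hz⟩
    refine ⟨N, hN, hz.trans_le ?_⟩
    refine (Finset.sum_le_sum fun n hn => hdom n z (Finset.mem_Ico.1 hn).1
      ((Finset.mem_Ico.1 hn).2.le.trans hN)).trans ?_
    exact Finset.sum_le_sum_of_subset_of_nonneg
      (fun n hn => Finset.mem_range.2 (Finset.mem_Ico.1 hn).2) fun n _ _ => hG0 _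
  have hS : MeasurableSet {z | ∃ N ≤ L, ε * N < ∑ n ∈ Finset.Ico m N, predictionGap μ K a n z} := by
    have : {z | ∃ N ≤ L, ε * N < ∑ n ∈ Finset.Ico m N, predictionGap μ K a n z} =
        ⋃ N ∈ Finset.Iic L, {z | ε * N < ∑ n ∈ Finset.Ico m N, predictionGap μ K a n z} := by
      ext z
      simp only [Set.mem_ofPred_eq, Set.mem_iUnion, Finset.mem_Iic, exists_prop]
    rw [this]
    exact Finset.measurableSet_biUnion _ fun N _ => measurableSet_lt measurable_const
      (Finset.measurable_fun_sum _ fun n _ => measurable_predictionGap a n)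
  calc P.real {z | ∃ N ≤ L, ε * N < ∑ n ∈ Finset.Ico m N, predictionGap μ K a n z}
      = P.real ((fiberShift Θ A)^[L] ⁻¹'
          {z | ∃ N ≤ L, ε * N < ∑ n ∈ Finset.Ico m N, predictionGap μ K a n z}) := by
        rw [measureReal_def, measureReal_def, (hT.iterate L).measure_preimage hS.nullMeasurableSet]
    _ ≤ P.real {z | ∃ N ≤ L, ε * N < birkhoffSum (fiberShift Θ A) G N z} :=
        measureReal_mono hsub (measure_ne_top _ _)
    _ ≤ (∫ z, G z ∂P) / ε := measureReal_exists_birkhoffSum_gt_le hT hG hGi hG0 hε L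
    _ ≤ _ := by
        rw [hGint]
        gcongr
        exact measureReal_exists_le_predictionGap_le hK hμ hsnd a hc hmL hδ

/-- The bound of `measureReal_exists_lt_sum_predictionGap_le` does not depend on the horizon `L`. -/
lemma measureReal_exists_lt_sum_predictionGap_le' [IsProbabilityMeasure lam] [IsMarkovKernel K]
    [IsFiniteMeasure μ] (hK : ∀ θ, Ergodic (shift A) (K θ))
    (hμ : MeasurePreserving (shift A) μ μ)
    (hsnd : MeasurePreserving Prod.snd (lam ⊗ₘ K) μ) (a : A) {c : ℝ}
    (hc : ∀ k, ∫ ω, predictive μ k ω a ^ 2 ∂μ ≤ c) (m : ℕ) {δ : ℝ} (hδ : 0 < δ)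
    {ε : ℝ} (hε : 0 < ε) :
    (lam ⊗ₘ K).real {z | ∃ N : ℕ, ε * N < ∑ n ∈ Finset.Ico m N, predictionGap μ K a n z} ≤
      (3 * δ + 3 * ((c - ∫ ω, predictive μ m ω a ^ 2 ∂μ) / δ ^ 2)) / ε := by
  let S : ℕ → Set (Θ × (ℕ → A)) := fun L =>
    {z | ∃ N ≤ L, ε * N < ∑ n ∈ Finset.Ico m N, predictionGap μ K a n z}
  have hset : {z | ∃ N : ℕ, ε * N < ∑ n ∈ Finset.Ico m N, predictionGap μ K a n z} = ⋃ L, S L := by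
    ext z
    simp only [S, Set.mem_ofPred_eq, Set.mem_iUnion]
    exact ⟨fun ⟨N, hN⟩ => ⟨N, N, le_rfl, hN⟩, fun ⟨_, N, _, hN⟩ => ⟨N, hN⟩⟩
  have hmono : Monotone S := fun L L' hL z ⟨N, hN, hz⟩ => ⟨N, hN.trans hL, hz⟩
  rw [hset]
  have hlim := (ENNReal.tendsto_toReal (measure_ne_top (lam ⊗ₘ K) (⋃ L, S L))).comp
    (tendsto_measure_iUnion_atTop (μ := lam ⊗ₘ K) hmono)
  refine le_of_tendsto hlim ?_
  filter_upwards [eventually_ge_atTop m] with L hL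
  exact measureReal_exists_lt_sum_predictionGap_le hK hμ hsnd a hc hL hδ hε

/-- The averages of the prediction gaps for a fixed letter tend to zero. The exceptional event
depends only on the tail of the sequence of gaps, so that the maximal inequality applies to it with
every starting time `m`; its bound vanishes as `m → ∞` and then `δ → 0`. -/
theorem ae_tendsto_average_predictionGap [IsProbabilityMeasure lam] [IsMarkovKernel K]
    [IsProbabilityMeasure μ] (hK : ∀ θ, Ergodic (shift A) (K θ))
    (hμ : MeasurePreserving (shift A) μ μ)
    (hsnd : MeasurePreserving Prod.snd (lam ⊗ₘ K) μ) (a : A) :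
    ∀ᵐ z ∂(lam ⊗ₘ K), Tendsto (fun N : ℕ =>
      (1 / (N : ℝ)) * ∑ n ∈ Finset.range N, predictionGap μ K a n z) atTop (𝓝 0) := by
  set s : ℕ → ℝ := fun k => ∫ ω, predictive μ k ω a ^ 2 ∂μ with hs
  have hsmono : Monotone s := by
    intro j k hjk
    have h := (isPrediction_predictive hμ hsnd hjk a).integral_sq_mono
      (isPrediction_predictive hμ hsnd (le_refl k) a) (pastAlgebra_mono hjk le_rfl)
      (pastAlgebra_le k k)
    rwa [integral_sq_shift_predictive hμ hsnd, integral_sq_shift_predictive hμ hsnd] at h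
  have hs1 : ∀ k, s k ≤ 1 := by
    intro k
    have : ∫ ω, predictive μ k ω a ^ 2 ∂μ ≤ ∫ _, (1 : ℝ) ∂μ := by
      refine integral_mono (integrable_sq_of_abs_le (measurable_predictive μ k a)
        fun ω => abs_predictive_le_one μ k ω a) (integrable_const 1) fun ω => ?_
      have := abs_le.1 (abs_predictive_le_one μ k ω a)
      dsimp only
      nlinarith
    simpa using this
  have hbdd : BddAbove (Set.range s) := ⟨1, by rintro _ ⟨k, rfl⟩; exact hs1 k⟩
  set c := ⨆ k, s k
  have hc : ∀ k, s k ≤ c := fun k => le_ciSup hbdd k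
  have hslim : Tendsto s atTop (𝓝 c) := tendsto_atTop_ciSup hsmono hbdd
  have key : ∀ ε : ℝ, 0 < ε → ∀ᵐ z ∂(lam ⊗ₘ K),
      ¬ ∃ᶠ N : ℕ in atTop, 2 * ε * N < ∑ n ∈ Finset.range N, predictionGap μ K a n z := by
    intro ε hε
    set F := {z | ∃ᶠ N : ℕ in atTop,
      2 * ε * N < ∑ n ∈ Finset.range N, predictionGap μ K a n z} with hF
    -- For large `N` the first `m` gaps contribute at most `m ≤ ε * N` to the sum.
    have hsub : ∀ m : ℕ, F ⊆
        {z | ∃ N : ℕ, ε * N < ∑ n ∈ Finset.Ico m N, predictionGap μ K a n z} := by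
      intro m z hz
      have hev : ∀ᶠ N : ℕ in atTop, m ≤ N ∧ (m : ℝ) ≤ ε * N := by
        refine (eventually_ge_atTop m).and ?_
        have : Tendsto (fun N : ℕ => ε * (N : ℝ)) atTop atTop :=
          tendsto_natCast_atTop_atTop.const_mul_atTop hε
        exact this.eventually_ge_atTop _
      obtain ⟨N, hN, hmN, hmε⟩ := (Frequently.and_eventually hz hev).exists
      refine ⟨N, ?_⟩
      rw [Finset.range_eq_Ico, ← Finset.sum_Ico_consecutive _ (Nat.zero_le m) hmN] at hN
      have h1 : ∑ n ∈ Finset.Ico 0 m, predictionGap μ K a n z ≤ m := by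
        have := Finset.sum_le_card_nsmul (Finset.Ico 0 m) (fun n => predictionGap μ K a n z) 1
          fun n _ => predictionGap_le_one a n z
        simpa using this
      linarith
    have hle : ∀ δ : ℝ, 0 < δ → (lam ⊗ₘ K).real F ≤ 3 * δ / ε := by
      intro δ hδ
      have hlim : Tendsto (fun m => (3 * δ + 3 * ((c - s m) / δ ^ 2)) / ε) atTop
          (𝓝 ((3 * δ + 3 * ((c - c) / δ ^ 2)) / ε)) :=
        ((((hslim.const_sub c).div_const _).const_mul 3).const_add _).div_const ε
      simp only [sub_self, zero_div, mul_zero, add_zero] at hlim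
      refine ge_of_tendsto' hlim fun m => ?_
      exact (measureReal_mono (hsub m) (measure_ne_top _ _)).trans
        (measureReal_exists_lt_sum_predictionGap_le' hK hμ hsnd a hc m hδ hε)
    have h0 : (lam ⊗ₘ K).real F = 0 := by
      refine le_antisymm (le_of_forall_pos_le_add fun η hη => ?_) measureReal_nonneg
      have := hle (η * ε / 3) (by positivity)
      have e : 3 * (η * ε / 3) / ε = η := by field_simp
      rw [zero_add]
      exact this.trans_eq e
    exact measure_eq_zero_iff_ae_notMem.1 ((measureReal_eq_zero_iff).1 h0)
  have key' : ∀ᵐ z ∂(lam ⊗ₘ K), ∀ j : ℕ, ¬ ∃ᶠ N : ℕ in atTop,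
      2 * (1 / ((j : ℝ) + 1)) * N < ∑ n ∈ Finset.range N, predictionGap μ K a n z :=
    ae_all_iff.2 fun j => key _ (by positivity)
  filter_upwards [key'] with z hz
  rw [tendsto_order]
  have hnonneg : ∀ N : ℕ,
      0 ≤ (1 / (N : ℝ)) * ∑ n ∈ Finset.range N, predictionGap μ K a n z := fun N =>
    mul_nonneg (by positivity) (Finset.sum_nonneg fun _ _ => predictionGap_nonneg _ _ _)
  refine ⟨fun b hb => Eventually.of_forall fun N => hb.trans_le (hnonneg N), fun b hb => ?_⟩
  obtain ⟨j, hj⟩ := exists_nat_one_div_lt (half_pos hb)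
  filter_upwards [not_frequently.1 (hz j), eventually_gt_atTop 0] with N hN hN0
  have hN0' : (0 : ℝ) < N := by exact_mod_cast hN0
  rw [not_lt] at hN
  rw [one_div, inv_mul_lt_iff₀ hN0']
  refine hN.trans_lt ?_
  rw [mul_comm]
  exact mul_lt_mul_of_pos_left (by linarith) hN0'

end Merging

/-! ### Weak learnability of the ergodic decomposition -/

section Learnability

variable {A : Type*} [Fintype A] [MeasurableSpace A]

/-- The ergodic laws as a Markov kernel: each law is the measure it parametrizes. -/
noncomputable def ergodicKernel (A : Type*) [MeasurableSpace A] : Kernel (ergodicLaws A) (ℕ → A) :=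
  ⟨fun ν => (ν : Measure (ℕ → A)), measurable_subtype_coe⟩

instance : IsMarkovKernel (ergodicKernel A) :=
  ⟨fun ν => (mem_ergodicLaws_iff.1 ν.2).1⟩

lemma ae_cylinder_pos (μ : Measure (ℕ → A)) : ∀ᵐ ω ∂μ, ∀ n, 0 < μ (cylinder n ω) := by
  refine ae_all_iff.2 fun n => ?_
  have h : ∀ᵐ ω ∂μ, ∀ w : Fin n → A, μ (initialWord n ⁻¹' {w}) = 0 → initialWord n ω ≠ w := by
    refine ae_all_iff.2 fun w => ?_
    by_cases h0 : μ (initialWord n ⁻¹' {w}) = 0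
    · filter_upwards [measure_eq_zero_iff_ae_notMem.1 h0] with ω hω _
      exact hω
    · exact ae_of_all _ fun ω h => absurd h h0
  filter_upwards [h] with ω hω
  rw [cylinder_eq_preimage]
  exact pos_iff_ne_zero.2 fun h0 => hω _ h0 rfl

/-- Letter by letter, the averaged prediction gap vanishes almost surely for the joint law of the
component and the sequence; the maximum norm is at most the sum over letters. -/
theorem IsErgodicDecomposition.weaklyLearnable [DiscreteMeasurableSpace A]
    {μ : Measure (ℕ → A)} (hμ : μ ∈ stationaryLaws A)
    {lam : Measure (ergodicLaws A)} (h : IsErgodicDecomposition μ lam) :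
    WeaklyLearnable μ lam (fun ν : ergodicLaws A => (ν : Measure (ℕ → A))) := by
  have hprob : IsProbabilityMeasure μ := hμ.1
  have hlam : IsProbabilityMeasure lam := h.prob_parameter
  have hsnd : MeasurePreserving Prod.snd (lam ⊗ₘ ergodicKernel A) μ := by
    refine ⟨measurable_snd, Measure.ext fun S hS => ?_⟩
    rw [Measure.map_apply measurable_snd hS, Measure.compProd_apply (measurable_snd hS),
      h.mixture S hS]
    rfl
  have h1 : ∀ᵐ z ∂(lam ⊗ₘ ergodicKernel A), ∀ a : A, Tendsto (fun N : ℕ => (1 / (N : ℝ)) *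
      ∑ n ∈ Finset.range N, predictionGap μ (ergodicKernel A) a n z) atTop (𝓝 0) :=
    ae_all_iff.2 fun a => ae_tendsto_average_predictionGap
      (fun ν => (mem_ergodicLaws_iff.1 ν.2).2) hμ.2 hsnd a
  filter_upwards [Measure.ae_ae_of_ae_compProd h1, h.ae_ae (ae_cylinder_pos μ)] with ν hν hpos
  filter_upwards [hν, hpos] with ω hω hω'
  refine ⟨hω', ?_⟩
  have hsum : Tendsto (fun N : ℕ => ∑ a : A, (1 / (N : ℝ)) *
      ∑ n ∈ Finset.range N, predictionGap μ (ergodicKernel A) a n (ν, ω)) atTop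
      (𝓝 (∑ _a : A, 0)) := tendsto_finsetSum _ fun a _ => hω a
  rw [Finset.sum_const_zero] at hsum
  refine squeeze_zero (fun N => mul_nonneg (by positivity)
    (Finset.sum_nonneg fun _ _ => abs_nonneg _)) (fun N => ?_) hsum
  rw [← Finset.mul_sum, Finset.sum_comm]
  refine mul_le_mul_of_nonneg_left (Finset.sum_le_sum fun n _ => ?_) (by positivity)
  rw [sub_zero, abs_of_nonneg (norm_nonneg _),
    pi_norm_le_iff_of_nonneg (Finset.sum_nonneg fun _ _ => predictionGap_nonneg _ _ _)]
  intro a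
  exact Finset.single_le_sum
    (f := fun a => predictionGap μ (ergodicKernel A) a n (ν, ω))
    (fun _ _ => predictionGap_nonneg _ _ _) (Finset.mem_univ a)

end Learnability
end ErgLearn

theorem mainTheorem1 {A : Type*} [Fintype A] [MeasurableSpace A] [DiscreteMeasurableSpace A]
    (μ : Measure (ℕ → A)) (hμ : μ ∈ ErgLearn.stationaryLaws A) :
    (∃! lam : Measure (ErgLearn.ergodicLaws A), ErgLearn.IsErgodicDecomposition μ lam) ∧
      ∀ lam : Measure (ErgLearn.ergodicLaws A), ErgLearn.IsErgodicDecomposition μ lam →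
        ErgLearn.WeaklyLearnable μ lam
          (fun ν : ErgLearn.ergodicLaws A => (ν : Measure (ℕ → A))) := by
  obtain ⟨lam, hlam⟩ := ErgLearn.exists_isErgodicDecomposition hμ
  exact ⟨⟨lam, hlam, fun lam' h' => ErgLearn.IsErgodicDecomposition.unique h' hlam⟩,
    fun lam' h' => ErgLearn.IsErgodicDecomposition.weaklyLearnable hμ h'⟩
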